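/- \textbf{Theorem (Moon in a puddle, Ionin--Pestov).} Let $a<b$ and let $\gamma\colon[a,b]\to\mathbb{R}^2$ be a simple smooth regular plane loop; that is, $\gamma$ has derivatives of all orders on $[a,b]$ (one-sided at the ends), $\gamma'(t)\neq 0$ for every $t\in[a,b]$, $\gamma(a)=\gamma(b)$, and $\gamma$ is injective on $[a,b)$. (The velocities at $a$ and $b$ need not agree, so the closed curve may have a corner or a cusp at its base $\gamma(a)=\gamma(b)$.) Suppose that the absolute curvature of $\gamma$ is at most $1$ at every $t\in[a,b]$, where the absolute curvature is $\kappa(t)=|T'(t)|/|\gamma'(t)|$ with $T=\gamma'/|\gamma'|$. Then $\gamma$ surrounds a unit disc: there is a closed disc of radius $1$ contained in the closed region bounded by $\gamma$, that is, in the union of the curve $\gamma([a,b])$ and the bounded connected component of its complement. -/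

import Mathlib

open scoped ContDiff

/-- The Euclidean plane. -/
abbrev Plane : Type := EuclideanSpace ℝ (Fin 2)

/-- `γ` restricted to `[a, b]` is a simple smooth regular plane loop with base `γ a = γ b`.
Smoothness and velocity at the ends `a`, `b` are one-sided, and nothing relates the velocities
(or higher derivatives) at `a` and at `b`: the closed curve may have a corner or a cusp at its
base. -/
structure IsSimpleSmoothRegularLoop (γ : ℝ → Plane) (a b : ℝ) : Prop where
  lt : a < b
  smooth : ContDiffOn ℝ ∞ γ (Set.Icc a b)
  regular : ∀ t ∈ Set.Icc a b, derivWithin γ (Set.Icc a b) t ≠ 0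
  closed : γ a = γ b
  simple : Set.InjOn γ (Set.Ico a b)

/-- The unit tangent vector `γ' / |γ'|` of a regular curve defined on the interval `I`. -/
noncomputable def unitTangent (γ : ℝ → Plane) (I : Set ℝ) (t : ℝ) : Plane :=
  ‖derivWithin γ I t‖⁻¹ • derivWithin γ I t

/-- The absolute curvature of a regular curve defined on the interval `I`: the magnitude of the
derivative of its unit tangent vector with respect to arc length (`ds = |γ'| dt`). For a
unit-speed curve this is `|γ''|`. -/
noncomputable def absCurvature (γ : ℝ → Plane) (I : Set ℝ) (t : ℝ) : ℝ :=
  ‖derivWithin (unitTangent γ I) I t‖ / ‖derivWithin γ I t‖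

/-- The region inside a closed curve with trace `Γ`: the points of the complement of `Γ` whose
connected component in the complement is bounded. -/
def insideRegion (Γ : Set Plane) : Set Plane :=
  {x | x ∉ Γ ∧ Bornology.IsBounded (connectedComponentIn Γᶜ x)}

/-- A closed curve with trace `Γ` surrounds the set `D` if `D` lies in the closed region bounded by
the curve, that is, in the union of the curve with the region inside it. -/
def Surrounds (Γ D : Set Plane) : Prop :=
  D ⊆ Γ ∪ insideRegion Γ

/-! Identify the plane with `ℂ` and suppose that every disc inscribed in the loop has radius less
than `1`. At a time `m` take the largest inscribed disc tangent to the loop at that time. By the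
curvature bound the loop, near `m`, stays outside the unit discs tangent to it there; so this disc
touches the loop at a second time, whose distance from `m` exceeds a bound `δ > 0` that does not
depend on `m`. The broken line from one point of contact through the centre to the other is a
crosscut, which cuts the inside of the loop in two. If the disc touches at the times `s` and `t`,
the disc for the time `(s + t) / 2` has its radii to the points of contact disjoint from that
crosscut, so its second contact also lies on the arc from `s` to `t`. Replacing `s` and `t` by the
new pair at least halves `|t - s|`, which cannot go on below `δ`.

The inside, and the two sides of a crosscut, are told apart by integrals of `dw / (w - z)` along
the loop and along the closed curves made of an arc and the crosscut. Such an integral is locally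
constant off its curve, as its exponential is `1`, and its jump across the curve is `2πi`.
-/

open Set Filter Topology

/-! ### Index integrals -/

theorem eq_of_isPreconnected_of_exp_eq_one {X : Type*} [TopologicalSpace X] {S : Set X}
    (hS : IsPreconnected S) {g : X → ℂ} (hg : ContinuousOn g S)
    (hexp : ∀ x ∈ S, Complex.exp (g x) = 1) {x y : X} (hx : x ∈ S) (hy : y ∈ S) : g x = g y :=
  Complex.isCoveringMap_exp.constOn_of_comp hS hg
    (fun _ ha _ ha' => Subtype.ext ((hexp _ ha).trans (hexp _ ha').symm)) hx hy

/-- A continuously differentiable plane curve `f`, defined for all times, with velocity `f'`. -/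
structure IsC1Curve (f f' : ℝ → ℂ) : Prop where
  cont : Continuous f'
  deriv : ∀ t, HasDerivAt f (f' t) t

/-- The integral of `dw / (w - z)` along the curve `f` with velocity `f'`, from time `s` to
time `t`. Over a loop this is `2πi` times the winding number around `z`; the factor is kept, so
that the integral is a difference of logarithms. -/
noncomputable def indexIntegral (f f' : ℝ → ℂ) (s t : ℝ) (z : ℂ) : ℂ :=
  ∫ u in s..t, f' u / (f u - z)

namespace IsC1Curve

variable {f f' : ℝ → ℂ} {r s t m : ℝ} {z e : ℂ}

theorem continuous (hf : IsC1Curve f f') : Continuous f :=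
  continuous_iff_continuousAt.2 fun t => (hf.deriv t).continuousAt

theorem isCompact_image (hf : IsC1Curve f f') (s t : ℝ) : IsCompact (f '' Icc s t) :=
  isCompact_Icc.image hf.continuous

theorem compl_image_mem_nhds (hf : IsC1Curve f f') (hz : z ∉ f '' Icc s t) :
    (f '' Icc s t)ᶜ ∈ 𝓝 z :=
  (hf.isCompact_image s t).isClosed.isOpen_compl.mem_nhds hz

theorem intervalIntegrable (hf : IsC1Curve f f') (hst : s ≤ t) (hz : z ∉ f '' Icc s t) :
    IntervalIntegrable (fun u => f' u / (f u - z)) MeasureTheory.volume s t :=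
  (hf.cont.continuousOn.div (hf.continuous.sub continuous_const).continuousOn fun u hu =>
    sub_ne_zero.2 fun h => hz ⟨u, uIcc_of_le hst ▸ hu, h⟩).intervalIntegrable

theorem indexIntegral_add (hf : IsC1Curve f f') (hrs : r ≤ s) (hst : s ≤ t)
    (hz : z ∉ f '' Icc r t) :
    indexIntegral f f' r s z + indexIntegral f f' s t z = indexIntegral f f' r t z :=
  intervalIntegral.integral_add_adjacent_intervals
    (hf.intervalIntegrable hrs fun h => hz (image_mono (Icc_subset_Icc_right hst) h))
    (hf.intervalIntegrable hst fun h => hz (image_mono (Icc_subset_Icc_left hrs) h))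

theorem hasDerivAt_indexIntegral (hf : IsC1Curve f f') (hst : s ≤ t)
    (hz : z ∉ f '' Icc s t) :
    HasDerivAt (fun v => indexIntegral f f' s v z) (f' t / (f t - z)) t :=
  intervalIntegral.integral_hasDerivAt_right (hf.intervalIntegrable hst hz)
    (hf.cont.measurable.div
      (hf.continuous.measurable.sub_const z)).stronglyMeasurable.stronglyMeasurableAtFilter
    (hf.cont.continuousAt.div (hf.continuous.continuousAt.sub continuousAt_const)
      (sub_ne_zero.2 fun h => hz ⟨t, right_mem_Icc.2 hst, h⟩))

theorem exp_indexIntegral (hf : IsC1Curve f f') (hst : s ≤ t) (hz : z ∉ f '' Icc s t) :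
    Complex.exp (indexIntegral f f' s t z) = (f t - z) / (f s - z) := by
  have hne : ∀ u ∈ Icc s t, f u - z ≠ 0 := fun u hu => sub_ne_zero.2 fun h => hz ⟨u, hu, h⟩
  have hder : ∀ u ∈ Icc s t,
      HasDerivAt (fun v => (f v - z) * Complex.exp (-indexIntegral f f' s v z)) 0 u := by
    intro u hu
    have hindex := hf.hasDerivAt_indexIntegral hu.1
      fun h => hz (image_mono (Icc_subset_Icc_right hu.2) h)
    refine (((hf.deriv u).sub_const z).mul hindex.neg.cexp).congr_deriv ?_
    have := hne u hu
    field_simp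
    ring
  have hconst : (f t - z) * Complex.exp (-indexIntegral f f' s t z) =
      (f s - z) * Complex.exp (-indexIntegral f f' s s z) :=
    constant_of_has_deriv_right_zero
      (fun u hu => (hder u hu).continuousAt.continuousWithinAt)
      (fun u hu => (hder u (Ico_subset_Icc_self hu)).hasDerivWithinAt) t (right_mem_Icc.2 hst)
  rw [indexIntegral, indexIntegral, intervalIntegral.integral_same, neg_zero, Complex.exp_zero,
    mul_one, Complex.exp_neg, mul_inv_eq_iff_eq_mul₀ (Complex.exp_ne_zero _)] at hconst
  rw [indexIntegral, hconst, mul_div_cancel_left₀ _ (hne s (left_mem_Icc.2 hst))]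

theorem continuousAt_indexIntegral (hf : IsC1Curve f f') (hst : s ≤ t)
    (hz : z ∉ f '' Icc s t) : ContinuousAt (indexIntegral f f' s t) z := by
  obtain ⟨d, hd, hball⟩ := Metric.mem_nhds_iff.1 (hf.compl_image_mem_nhds hz)
  obtain ⟨M, hM⟩ := (isCompact_Icc (a := s) (b := t)).exists_bound_of_continuousOn
    hf.cont.continuousOn
  have hfar : ∀ w ∈ Metric.ball z (d / 2), ∀ u ∈ Icc s t, d / 2 ≤ ‖f u - w‖ := by
    intro w hw u hu
    by_contra! h
    have hsum : dist (f u) z < d / 2 + d / 2 :=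
      (dist_triangle _ w _).trans_lt (add_lt_add (dist_eq_norm (f u) w ▸ h) hw)
    exact hball (hsum.trans_eq (add_halves d)) ⟨u, hu, rfl⟩
  have hmem : ∀ u ∈ uIoc s t, u ∈ Icc s t := fun u hu =>
    Ioc_subset_Icc_self (uIoc_of_le hst ▸ hu)
  refine intervalIntegral.continuousAt_of_dominated_interval (bound := fun _ => M / (d / 2))
    (Eventually.of_forall fun w => (hf.cont.measurable.div
      (hf.continuous.measurable.sub_const w)).aestronglyMeasurable)
    ?_ intervalIntegrable_const ?_
  · filter_upwards [Metric.ball_mem_nhds z (half_pos hd)] with w hw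
    refine Eventually.of_forall fun u hu => ?_
    rw [norm_div]
    exact div_le_div₀ ((norm_nonneg _).trans (hM u (hmem u hu))) (hM u (hmem u hu)) (half_pos hd)
      (hfar w hw u (hmem u hu))
  · exact Eventually.of_forall fun u hu =>
      continuousAt_const.div (continuousAt_const.sub continuousAt_id)
        (sub_ne_zero.2 fun h => hz ⟨u, hmem u hu, h⟩)

theorem indexIntegral_eq_log_sub (hf : IsC1Curve f f') (hst : s ≤ t)
    (h : ∀ u ∈ Icc s t, e * (f u - z) ∈ Complex.slitPlane) :
    indexIntegral f f' s t z = Complex.log (e * (f t - z)) - Complex.log (e * (f s - z)) := by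
  have hne : ∀ u ∈ Icc s t, e * (f u - z) ≠ 0 := fun u hu => Complex.slitPlane_ne_zero (h u hu)
  refine intervalIntegral.integral_eq_sub_of_hasDerivAt
    (f := fun u => Complex.log (e * (f u - z))) (fun u hu => ?_)
    (hf.intervalIntegrable hst ?_)
  · rw [uIcc_of_le hst] at hu
    have hlog := (((hf.deriv u).sub_const z).const_mul e).clog_real (h u hu)
    rwa [mul_div_mul_left _ _ (left_ne_zero_of_mul (hne u hu))] at hlog
  · rintro ⟨u, hu, rfl⟩
    exact hne u hu (by rw [sub_self, mul_zero])

theorem indexIntegral_eq_zero_of_ray (hf : IsC1Curve f f') (hst : s ≤ t) (hclosed : f s = f t)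
    {d : ℂ} (hd : d ≠ 0) (hray : ∀ r : ℝ, 0 ≤ r → z + r * d ∉ f '' Icc s t) :
    indexIntegral f f' s t z = 0 := by
  suffices h : ∀ u ∈ Icc s t, -d⁻¹ * (f u - z) ∈ Complex.slitPlane by
    rw [hf.indexIntegral_eq_log_sub hst h, hclosed, sub_self]
  intro u hu
  rw [Complex.mem_slitPlane_iff_not_le_zero, Complex.le_def]
  rintro ⟨hre, him⟩
  refine hray (-(-d⁻¹ * (f u - z)).re) (neg_nonneg.2 hre) ⟨u, hu, ?_⟩
  have hreal : ((-d⁻¹ * (f u - z)).re : ℂ) = -d⁻¹ * (f u - z) :=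
    Complex.ext (Complex.ofReal_re _) (by rw [Complex.ofReal_im, him, Complex.zero_im])
  rw [Complex.ofReal_neg, hreal]
  field_simp
  ring

theorem exists_strictMonoOn_re (hf : IsC1Curve f f') (hm : f' m ≠ 0) :
    ∃ ε > 0, ∀ u ∈ Icc (m - ε) (m + ε),
      StrictMonoOn (fun v => (f v / f' u).re) (Icc (m - ε) (m + ε)) := by
  have hpos : ∀ᶠ p : ℝ × ℝ in 𝓝 (m, m), 0 < (f' p.2 / f' p.1).re := by
    have hcont : ContinuousAt (fun p : ℝ × ℝ => f' p.2 / f' p.1) (m, m) :=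
      (hf.cont.comp continuous_snd).continuousAt.div (hf.cont.comp continuous_fst).continuousAt hm
    exact (Complex.continuous_re.continuousAt.comp hcont).eventually_const_lt
      (by simp [div_self hm])
  obtain ⟨ε, hε, hball⟩ := Metric.nhds_basis_closedBall.eventually_iff.1 hpos
  rw [← closedBall_prod_same, Real.closedBall_eq_Icc] at hball
  refine ⟨ε, hε, fun u hu => strictMonoOn_of_hasDerivWithinAt_pos (f' := fun v => (f' v / f' u).re)
    (convex_Icc _ _) ?_ (fun v _ => ?_)
    fun v hv => hball (Set.mk_mem_prod hu (interior_subset hv))⟩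
  · exact (Complex.continuous_re.comp (hf.continuous.div_const _)).continuousOn
  · exact (Complex.reCLM.hasFDerivAt.comp_hasDerivAt v
      ((hf.deriv v).div_const _)).hasDerivWithinAt

end IsC1Curve

/-! ### The two sides of a simple loop -/

/-- `f` is a simple regular `C¹` plane loop on `[a, b]`, extended to all times as a regular
curve. -/
structure IsSimpleC1Loop (f f' : ℝ → ℂ) (a b : ℝ) : Prop extends IsC1Curve f f' where
  lt : a < b
  ne : ∀ t, f' t ≠ 0
  closed : f a = f b
  inj : InjOn f (Ico a b)

/-- The unit vector normal to the velocity `f' m`, pointing to the left of the curve for `σ = 1`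
and to its right for `σ = -1`. -/
noncomputable def sideNormal (f' : ℝ → ℂ) (σ m : ℝ) : ℂ :=
  σ * Complex.I * f' m / ‖f' m‖

/-- The index integral of the loop takes the value `k` on the normal to the left (`σ = 1`) or to
the right (`σ = -1`) of the loop at time `m`, close to the loop. -/
def IsSideValue (f f' : ℝ → ℂ) (a b σ m : ℝ) (k : ℂ) : Prop :=
  ∀ᶠ y : ℝ in 𝓝[>] 0, indexIntegral f f' a b (f m + y * sideNormal f' σ m) = k

/-- On `[m - ε, m + ε] ⊆ [a, b]` the curve progresses strictly in the direction `f' m`. -/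
structure IsGraphWindow (f f' : ℝ → ℂ) (a b m ε : ℝ) : Prop where
  pos : 0 < ε
  left_le : a ≤ m - ε
  le_right : m + ε ≤ b
  strictMonoOn : StrictMonoOn (fun u => (f u / f' m).re) (Icc (m - ε) (m + ε))

/-- The Cauchy principal value at `f m` of the index integral, evaluated by cutting out a graph
window `[m - ε, m + ε]`, along which `log ((f u - f m) / f' m)` is a primitive on either side
of `m`. -/
noncomputable def principalValue (f f' : ℝ → ℂ) (a b m ε : ℝ) : ℂ :=
  indexIntegral f f' a (m - ε) (f m) + indexIntegral f f' (m + ε) b (f m) +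
    (Complex.log ((f (m + ε) - f m) / f' m) - Complex.log ((f m - f (m - ε)) / f' m))

theorem norm_sideNormal {f' : ℝ → ℂ} {σ m : ℝ} (hm : f' m ≠ 0) (hσ : |σ| = 1) :
    ‖sideNormal f' σ m‖ = 1 := by
  simp [sideNormal, hσ, hm]

theorem exists_eq_mul_sideNormal {f' : ℝ → ℂ} {m : ℝ} {w : ℂ} (hm : f' m ≠ 0) (hw : w ≠ 0)
    (horth : (w / f' m).re = 0) : ∃ σ : ℝ, |σ| = 1 ∧ w = ‖w‖ * sideNormal f' σ m := by
  have him : w / f' m = (w / f' m).im * Complex.I :=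
    Complex.ext (by simp [horth]) (by simp)
  have hnorm : |(w / f' m).im| = ‖w‖ / ‖f' m‖ := by
    rw [← norm_div, ← Complex.abs_im_eq_norm.2 horth]
  have hne : (w / f' m).im ≠ 0 := fun h => div_ne_zero hw hm (by rw [him, h]; simp)
  refine ⟨(w / f' m).im / |(w / f' m).im|, by rw [abs_div, abs_abs, div_self (abs_ne_zero.2 hne)],
    ?_⟩
  have hnw : (‖w‖ : ℂ) ≠ 0 := by exact_mod_cast norm_ne_zero_iff.2 hw
  have hnm : (‖f' m‖ : ℂ) ≠ 0 := by exact_mod_cast norm_ne_zero_iff.2 hm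
  rw [div_eq_iff hm] at him
  rw [hnorm, sideNormal]
  push_cast
  field_simp
  linear_combination him

theorem log_mul_I_of_re_pos {σ : ℝ} (hσ : |σ| = 1) {w : ℂ} (hw : 0 < w.re) :
    Complex.log (σ * Complex.I * w) = Complex.log w + σ * (Real.pi / 2) * Complex.I := by
  have hw0 : w ≠ 0 := fun h => hw.ne' (by simp [h])
  have harg := abs_lt.1 (Complex.abs_arg_lt_pi_div_two_iff.2 (Or.inl hw))
  rcases (abs_eq zero_le_one).1 hσ with rfl | rfl
  · have hlog := Complex.log_mul_eq_add_log_iff Complex.I_ne_zero hw0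
    rw [Complex.arg_I, mem_Ioc] at hlog
    rw [Complex.ofReal_one, one_mul, hlog.2 ⟨by linarith [Real.pi_pos], by linarith⟩, Complex.log_I]
    ring
  · have hlog := Complex.log_mul_eq_add_log_iff (neg_ne_zero.2 Complex.I_ne_zero) hw0
    rw [Complex.arg_neg_I, mem_Ioc] at hlog
    rw [Complex.ofReal_neg, Complex.ofReal_one, neg_one_mul,
      hlog.2 ⟨by linarith, by linarith [Real.pi_pos]⟩, Complex.log_neg_I]
    ring

theorem mul_I_mul_mem_slitPlane {σ : ℝ} (hσ : |σ| = 1) {w : ℂ} (hw : w.re ≠ 0) :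
    σ * Complex.I * w ∈ Complex.slitPlane := by
  refine Complex.mem_slitPlane_iff.2 (Or.inr ?_)
  have hσ0 : σ ≠ 0 := abs_ne_zero.1 (hσ.trans_ne one_ne_zero)
  simpa [mul_assoc] using ⟨hσ0, hw⟩

theorem IsSideValue.unique {f f' : ℝ → ℂ} {a b σ m : ℝ} {k k' : ℂ}
    (h : IsSideValue f f' a b σ m k) (h' : IsSideValue f f' a b σ m k') : k = k' := by
  obtain ⟨y, hk, hk'⟩ := (h.and h').exists
  exact hk.symm.trans hk'

namespace IsSimpleC1Loop

variable {f f' : ℝ → ℂ} {a b m m' σ ε : ℝ} {k : ℂ}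

theorem eq_of_eq (hf : IsSimpleC1Loop f f' a b) {u : ℝ} (hm : m ∈ Ioo a b) (hu : u ∈ Icc a b)
    (h : f u = f m) : u = m := by
  rcases hu.2.lt_or_eq with hub | rfl
  · exact hf.inj ⟨hu.1, hub⟩ ⟨hm.1.le, hm.2⟩ h
  · exact absurd (hf.inj ⟨le_rfl, hf.lt⟩ ⟨hm.1.le, hm.2⟩ (hf.closed.trans h)) hm.1.ne

theorem notMem_image (hf : IsSimpleC1Loop f f' a b) {s t : ℝ} (hm : m ∈ Ioo a b) (has : a ≤ s)
    (htb : t ≤ b) (hst : m ∉ Icc s t) : f m ∉ f '' Icc s t := by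
  rintro ⟨u, hu, h⟩
  exact hst (hf.eq_of_eq hm ⟨has.trans hu.1, hu.2.trans htb⟩ h ▸ hu)

theorem exp_indexIntegral_eq_one (hf : IsSimpleC1Loop f f' a b) {z : ℂ} (hz : z ∉ f '' Icc a b) :
    Complex.exp (indexIntegral f f' a b z) = 1 := by
  rw [hf.exp_indexIntegral hf.lt.le hz, ← hf.closed, div_self]
  exact sub_ne_zero.2 fun h => hz ⟨a, left_mem_Icc.2 hf.lt.le, h⟩

theorem continuousOn_indexIntegral (hf : IsSimpleC1Loop f f' a b) :
    ContinuousOn (indexIntegral f f' a b) (f '' Icc a b)ᶜ :=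
  fun _ hz => (hf.continuousAt_indexIntegral hf.lt.le hz).continuousWithinAt

theorem indexIntegral_eq_of_isPreconnected (hf : IsSimpleC1Loop f f' a b) {S : Set ℂ}
    (hS : IsPreconnected S) (hdisj : S ⊆ (f '' Icc a b)ᶜ) {x y : ℂ} (hx : x ∈ S) (hy : y ∈ S) :
    indexIntegral f f' a b x = indexIntegral f f' a b y :=
  eq_of_isPreconnected_of_exp_eq_one hS (hf.continuousOn_indexIntegral.mono hdisj)
    (fun _ hz => hf.exp_indexIntegral_eq_one (hdisj hz)) hx hy

theorem eventually_eq_imp_mem_Ioo (hf : IsSimpleC1Loop f f' a b) (hm : m ∈ Ioo a b) (hε : 0 < ε) :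
    ∀ᶠ z in 𝓝 (f m), ∀ v ∈ Icc a b, f v = z → v ∈ Ioo (m - ε) (m + ε) := by
  have hK : IsCompact (f '' (Icc a b \ Ioo (m - ε) (m + ε))) :=
    (isCompact_Icc.diff isOpen_Ioo).image hf.continuous
  have hmK : f m ∉ f '' (Icc a b \ Ioo (m - ε) (m + ε)) := by
    rintro ⟨u, ⟨hu, hum⟩, h⟩
    rw [hf.eq_of_eq hm hu h] at hum
    exact hum ⟨by linarith, by linarith⟩
  filter_upwards [hK.isClosed.isOpen_compl.mem_nhds hmK] with z hz v hv hvz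
  by_contra h
  exact hz ⟨v, ⟨hv, h⟩, hvz⟩

theorem continuous_add_mul_sideNormal (hf : IsSimpleC1Loop f f' a b) (σ : ℝ) :
    Continuous fun p : ℝ × ℝ => f p.1 + p.2 * sideNormal f' σ p.1 := by
  have hnormal : Continuous (sideNormal f' σ) :=
    (continuous_const.mul hf.cont).div (Complex.continuous_ofReal.comp hf.cont.norm)
      fun u => by exact_mod_cast norm_ne_zero_iff.2 (hf.ne u)
  exact (hf.continuous.comp continuous_fst).add
    ((Complex.continuous_ofReal.comp continuous_snd).mul (hnormal.comp continuous_fst))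

/-- A continuous normal field need not be differentiable, so the tubular neighbourhood is obtained
from monotonicity in the direction of the velocity and not from the inverse function theorem. -/
theorem eventually_add_mul_sideNormal_notMem (hf : IsSimpleC1Loop f f' a b) (hm : m ∈ Ioo a b)
    (hσ : |σ| = 1) : ∀ᶠ p : ℝ × ℝ in 𝓝 (m, 0),
      p.2 ≠ 0 → f p.1 + p.2 * sideNormal f' σ p.1 ∉ f '' Icc a b := by
  obtain ⟨ε, hε, hmono⟩ := hf.exists_strictMonoOn_re (hf.ne m)
  have hnear := (hf.continuous_add_mul_sideNormal σ).continuousAt (x := (m, 0)) |>.eventually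
    (p := fun z => ∀ v ∈ Icc a b, f v = z → v ∈ Ioo (m - ε) (m + ε))
    (by simpa using hf.eventually_eq_imp_mem_Ioo hm hε)
  have hwindow : ∀ᶠ p : ℝ × ℝ in 𝓝 (m, 0), p.1 ∈ Icc (m - ε) (m + ε) :=
    continuousAt_fst.eventually_mem (Icc_mem_nhds (by simpa using hε) (by simpa using hε))
  filter_upwards [hnear, hwindow] with ⟨u, y⟩ hnear hu hy
  rintro ⟨v, hv, hvu⟩
  have hre : (f v / f' u).re = (f u / f' u).re := by
    have hnormal : y * sideNormal f' σ u / f' u = (y * σ / ‖f' u‖ : ℝ) * Complex.I := by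
      have := hf.ne u
      rw [sideNormal]
      push_cast
      field_simp
    rw [hvu, add_div, hnormal, Complex.add_re, Complex.re_ofReal_mul, Complex.I_re, mul_zero,
      add_zero]
  have hvu' := (hmono u hu).injOn (Ioo_subset_Icc_self (hnear v hv hvu)) hu hre
  rw [hvu', left_eq_add, mul_eq_zero, Complex.ofReal_eq_zero] at hvu
  have hnorm := norm_sideNormal (hf.ne u) hσ
  rcases hvu with h | h
  · exact hy h
  · rw [h, norm_zero] at hnorm
    exact zero_ne_one hnorm

theorem exists_eventually_isSideValue (hf : IsSimpleC1Loop f f' a b) (hm : m ∈ Ioo a b)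
    (hσ : |σ| = 1) : ∃ k, ∀ᶠ u in 𝓝 m, IsSideValue f f' a b σ u k := by
  obtain ⟨ε, hε, htube⟩ :=
    Metric.eventually_nhds_iff.1 (hf.eventually_add_mul_sideNormal_notMem hm hσ)
  set S : Set (ℝ × ℝ) := Metric.ball m ε ×ˢ Ioo 0 ε
  have hoff : ∀ p ∈ S, f p.1 + p.2 * sideNormal f' σ p.1 ∉ f '' Icc a b := fun p hp =>
    htube (max_lt hp.1 (by rw [Real.dist_0_eq_abs, abs_of_pos hp.2.1]; exact hp.2.2)) hp.2.1.ne'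
  have hcont : ContinuousOn
      (fun p : ℝ × ℝ => indexIntegral f f' a b (f p.1 + p.2 * sideNormal f' σ p.1)) S :=
    hf.continuousOn_indexIntegral.comp (hf.continuous_add_mul_sideNormal σ).continuousOn hoff
  have hS : IsPreconnected S := (convex_ball m ε).isPreconnected.prod isPreconnected_Ioo
  have hmid : (m, ε / 2) ∈ S := ⟨Metric.mem_ball_self hε, half_pos hε, half_lt_self hε⟩
  refine ⟨indexIntegral f f' a b (f m + (ε / 2 : ℝ) * sideNormal f' σ m),
    eventually_of_mem (Metric.ball_mem_nhds m hε) fun u hu => ?_⟩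
  filter_upwards [Ioo_mem_nhdsGT hε] with y hy
  exact eq_of_isPreconnected_of_exp_eq_one hS hcont
    (fun p hp => hf.exp_indexIntegral_eq_one (hoff p hp)) (x := (u, y)) (y := (m, ε / 2))
    ⟨hu, hy⟩ hmid

theorem isSideValue_of_mem_Ioo (hf : IsSimpleC1Loop f f' a b) (hm : m ∈ Ioo a b)
    (hm' : m' ∈ Ioo a b) (hσ : |σ| = 1) (h : IsSideValue f f' a b σ m k) :
    IsSideValue f f' a b σ m' k := by
  refine (isPreconnected_Ioo.induction₂
    (fun u v => ∀ k, IsSideValue f f' a b σ u k ↔ IsSideValue f f' a b σ v k)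
    (fun u hu => ?_) (fun _ _ _ _ _ _ huv hvw k => (huv k).trans (hvw k))
    (fun _ _ _ _ huv k => (huv k).symm) hm hm' k).1 h
  obtain ⟨l, hl⟩ := hf.exists_eventually_isSideValue hu hσ
  filter_upwards [nhdsWithin_le_nhds hl] with v hv k
  exact ⟨fun hk => hl.self_of_nhds.unique hk ▸ hv, fun hk => hv.unique hk ▸ hl.self_of_nhds⟩

theorem exists_isGraphWindow (hf : IsSimpleC1Loop f f' a b) (hm : m ∈ Ioo a b) :
    ∃ ε, IsGraphWindow f f' a b m ε := by
  obtain ⟨δ, hδ, hmono⟩ := hf.exists_strictMonoOn_re (hf.ne m)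
  obtain ⟨ε, hε, hεmin⟩ := exists_between
    (lt_min hδ (lt_min (sub_pos.2 hm.1) (sub_pos.2 hm.2)))
  simp only [lt_min_iff] at hεmin
  exact ⟨ε, hε, by linarith, by linarith, (hmono m ⟨by linarith, by linarith⟩).mono
    (Icc_subset_Icc (by linarith) (by linarith))⟩

end IsSimpleC1Loop

namespace IsGraphWindow

variable {f f' : ℝ → ℂ} {a b m ε : ℝ}

theorem re_pos (h : IsGraphWindow f f' a b m ε) {u v : ℝ} (hu : m - ε ≤ u) (huv : u < v)
    (hv : v ≤ m + ε) : 0 < ((f v - f u) / f' m).re := by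
  rw [sub_div, Complex.sub_re, sub_pos]
  exact h.strictMonoOn ⟨hu, huv.le.trans hv⟩ ⟨hu.trans huv.le, hv⟩ huv

theorem mem_Ioo (h : IsGraphWindow f f' a b m ε) : m ∈ Ioo a b :=
  ⟨by linarith [h.pos, h.left_le], by linarith [h.pos, h.le_right]⟩

theorem mono (h : IsGraphWindow f f' a b m ε) {δ : ℝ} (hδ : 0 < δ) (hδε : δ ≤ ε) :
    IsGraphWindow f f' a b m δ where
  pos := hδ
  left_le := by linarith [h.left_le]
  le_right := by linarith [h.le_right]
  strictMonoOn := h.strictMonoOn.mono (Icc_subset_Icc (by linarith) (by linarith))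

theorem indexIntegral_add_add (h : IsGraphWindow f f' a b m ε) (hf : IsC1Curve f f') {z : ℂ}
    (hz : z ∉ f '' Icc a b) :
    indexIntegral f f' a (m - ε) z + indexIntegral f f' (m + ε) b z +
      indexIntegral f f' (m - ε) (m + ε) z = indexIntegral f f' a b z := by
  have hmid : m - ε ≤ m + ε := by linarith [h.pos]
  rw [← hf.indexIntegral_add (h.left_le.trans hmid) h.le_right hz,
    ← hf.indexIntegral_add h.left_le hmid
      fun hz' => hz (image_mono (Icc_subset_Icc_right h.le_right) hz')]
  ring

end IsGraphWindow

theorem tendsto_add_mul_sideNormal (f f' : ℝ → ℂ) (σ m : ℝ) :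
    Tendsto (fun y : ℝ => f m + y * sideNormal f' σ m) (𝓝[>] 0) (𝓝 (f m)) := by
  have hcont : Continuous fun y : ℝ => f m + y * sideNormal f' σ m := by fun_prop
  simpa using (hcont.tendsto 0).mono_left nhdsWithin_le_nhds

theorem tendsto_log_mul_I_div_mul_sub {f f' : ℝ → ℂ} {σ m u : ℝ} (hσ : |σ| = 1)
    (hu : ((f u - f m) / f' m).re ≠ 0) : Tendsto
      (fun y : ℝ => Complex.log (σ * Complex.I / f' m * (f u - (f m + y * sideNormal f' σ m))))
      (𝓝[>] 0) (𝓝 (Complex.log (σ * Complex.I * ((f u - f m) / f' m)))) := by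
  have hslit := mul_I_mul_mem_slitPlane hσ hu
  have hcomm : σ * Complex.I * ((f u - f m) / f' m) = σ * Complex.I / f' m * (f u - f m) := by
    ring
  rw [hcomm] at hslit ⊢
  have hcont : ContinuousAt (fun z => Complex.log (σ * Complex.I / f' m * (f u - z))) (f m) :=
    (continuousAt_const.mul (continuousAt_const.sub continuousAt_id)).clog hslit
  exact hcont.tendsto.comp (tendsto_add_mul_sideNormal f f' σ m)

namespace IsSimpleC1Loop

variable {f f' : ℝ → ℂ} {a b m σ ε : ℝ} {k : ℂ}

theorem mul_I_div_mul_sub_mem_slitPlane (hf : IsSimpleC1Loop f f' a b)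
    (h : IsGraphWindow f f' a b m ε) (hσ : |σ| = 1) {u y : ℝ} (hu : u ∈ Icc (m - ε) (m + ε))
    (hy : 0 < y) :
    σ * Complex.I / f' m * (f u - (f m + y * sideNormal f' σ m)) ∈ Complex.slitPlane := by
  have hm : (‖f' m‖ : ℂ) ≠ 0 := by exact_mod_cast norm_ne_zero_iff.2 (hf.ne m)
  have hσ2 : (σ : ℂ) ^ 2 = 1 := by
    rw [← Complex.ofReal_pow, ← sq_abs, hσ, one_pow, Complex.ofReal_one]
  have hsplit : σ * Complex.I / f' m * (f u - (f m + y * sideNormal f' σ m)) =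
      σ * Complex.I * ((f u - f m) / f' m) + (y / ‖f' m‖ : ℝ) := by
    rw [sideNormal]
    push_cast
    field_simp [hf.ne m]
    linear_combination (-y : ℂ) * Complex.I ^ 2 * f' m * hσ2 - y * f' m * Complex.I_sq
  rcases eq_or_ne u m with rfl | hum
  · rw [hsplit, sub_self, zero_div, mul_zero, zero_add]
    exact Complex.ofReal_mem_slitPlane.2 (div_pos hy (norm_pos_iff.2 (hf.ne _)))
  · have hre : ((f u - f m) / f' m).re ≠ 0 := by
      rw [sub_div, Complex.sub_re, sub_ne_zero]
      exact h.strictMonoOn.injOn.ne hu ⟨by linarith [h.pos], by linarith [h.pos]⟩ hum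
    refine Complex.mem_slitPlane_iff.2 (Or.inr ?_)
    have hσ0 : σ ≠ 0 := abs_ne_zero.1 (hσ.trans_ne one_ne_zero)
    rw [hsplit]
    simpa [mul_assoc] using ⟨hσ0, hre⟩

theorem eventually_nhdsGT_notMem (hf : IsSimpleC1Loop f f' a b) (hm : m ∈ Ioo a b)
    (hσ : |σ| = 1) : ∀ᶠ y : ℝ in 𝓝[>] 0, f m + y * sideNormal f' σ m ∉ f '' Icc a b := by
  have htube := (Continuous.prodMk_right m).tendsto (0 : ℝ) |>.eventually
    (hf.eventually_add_mul_sideNormal_notMem hm hσ)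
  filter_upwards [nhdsWithin_le_nhds htube, self_mem_nhdsWithin] with y hy hy0 using hy hy0.ne'

/-- This is the Sokhotski–Plemelj formula. -/
theorem tendsto_indexIntegral_sideNormal (hf : IsSimpleC1Loop f f' a b)
    (h : IsGraphWindow f f' a b m ε) (hσ : |σ| = 1) :
    Tendsto (fun y : ℝ => indexIntegral f f' a b (f m + y * sideNormal f' σ m)) (𝓝[>] 0)
      (𝓝 (principalValue f f' a b m ε + σ * Real.pi * Complex.I)) := by
  have hε := h.pos
  have hz := tendsto_add_mul_sideNormal f f' σ m
  have hleft := (hf.continuousAt_indexIntegral h.left_le (hf.notMem_image h.mem_Ioo le_rfl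
    (h.mem_Ioo.2.le.trans' (by linarith)) fun hm => by linarith [hm.2])).tendsto.comp hz
  have hright := (hf.continuousAt_indexIntegral h.le_right (hf.notMem_image h.mem_Ioo
    (h.mem_Ioo.1.le.trans (by linarith)) le_rfl fun hm => by linarith [hm.1])).tendsto.comp hz
  have hpos := h.re_pos (by linarith) (lt_add_of_pos_right m hε) le_rfl
  have hneg := h.re_pos le_rfl (sub_lt_self m hε) (by linarith)
  have hlogs := (tendsto_log_mul_I_div_mul_sub hσ hpos.ne').sub
    (tendsto_log_mul_I_div_mul_sub (f := f) (f' := f') (m := m) (u := m - ε) hσ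
      (by rw [← neg_sub, neg_div, Complex.neg_re]; exact (neg_neg_of_pos hneg).ne))
  have hflip : σ * Complex.I * ((f (m - ε) - f m) / f' m) =
      (-σ : ℝ) * Complex.I * ((f m - f (m - ε)) / f' m) := by
    push_cast
    ring
  rw [log_mul_I_of_re_pos hσ hpos, hflip, log_mul_I_of_re_pos (by rwa [abs_neg]) hneg] at hlogs
  have hsum := (hleft.add hright).add hlogs
  refine (hsum.congr' ?_).trans_eq ?_
  · filter_upwards [hf.eventually_nhdsGT_notMem h.mem_Ioo hσ, self_mem_nhdsWithin] with y hy hy0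
    rw [← h.indexIntegral_add_add hf.toIsC1Curve hy, hf.indexIntegral_eq_log_sub (by linarith)
      fun u hu => hf.mul_I_div_mul_sub_mem_slitPlane h hσ hu hy0]
    rfl
  · rw [principalValue]
    push_cast
    congr 1
    ring

theorem eq_of_isSideValue (hf : IsSimpleC1Loop f f' a b) (h : IsGraphWindow f f' a b m ε)
    (hσ : |σ| = 1) (hk : IsSideValue f f' a b σ m k) :
    k = principalValue f f' a b m ε + σ * Real.pi * Complex.I :=
  tendsto_nhds_unique (tendsto_const_nhds.congr' (hk.mono fun _ hy => hy.symm))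
    (hf.tendsto_indexIntegral_sideNormal h hσ)

theorem exists_mem_Ioo_forall_dist_le (hf : IsSimpleC1Loop f f' a b) :
    ∃ m ∈ Ioo a b, ∀ u ∈ Icc a b, dist (f u) (f a) ≤ dist (f m) (f a) := by
  obtain ⟨m, hm, hmax⟩ := isCompact_Icc.exists_isMaxOn (nonempty_Icc.2 hf.lt.le)
    (hf.continuous.dist continuous_const).continuousOn (f := fun u => dist (f u) (f a))
  obtain ⟨u, hu⟩ := nonempty_Ioo.2 hf.lt
  have hpos : 0 < dist (f m) (f a) := by
    refine (dist_pos.2 fun h => ?_).trans_le (hmax (Ioo_subset_Icc_self hu))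
    exact hu.1.ne (hf.eq_of_eq hu (left_mem_Icc.2 hf.lt.le) h.symm)
  rw [dist_pos] at hpos
  exact ⟨m, ⟨hm.1.lt_of_ne fun h => hpos (by rw [h]),
    hm.2.lt_of_ne fun h => hpos (by rw [h, hf.closed])⟩, hmax⟩

theorem re_div_eq_zero_of_isLocalExtr_dist {p : ℂ} (hf : IsSimpleC1Loop f f' a b)
    (h : IsLocalExtr (fun u => dist (f u) p) m) : ((f m - p) / f' m).re = 0 := by
  have hder := ((hf.deriv m).sub_const p).norm_sq
  have hext : IsLocalExtr (fun u => ‖f u - p‖ ^ 2) m := by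
    simp only [dist_eq_norm] at h
    exact h.imp
      (fun h => h.mono fun u hu => pow_le_pow_left₀ (norm_nonneg _) hu 2)
      (fun h => h.mono fun u hu => pow_le_pow_left₀ (norm_nonneg _) hu 2)
  have hinner := hext.hasDerivAt_eq_zero hder
  rw [Complex.inner, Complex.mul_re, Complex.conj_re, Complex.conj_im] at hinner
  rw [Complex.div_re, ← add_div, div_eq_zero_iff]
  left
  linarith

theorem exists_isSideValue_zero (hf : IsSimpleC1Loop f f' a b) :
    ∃ σ : ℝ, |σ| = 1 ∧ ∀ m ∈ Ioo a b, IsSideValue f f' a b σ m 0 := by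
  obtain ⟨m, hm, hmax⟩ := hf.exists_mem_Ioo_forall_dist_le
  have hne : f m - f a ≠ 0 := sub_ne_zero.2 fun h =>
    hm.1.ne (hf.eq_of_eq hm (left_mem_Icc.2 hf.lt.le) h.symm)
  obtain ⟨σ, hσ, hnormal⟩ := exists_eq_mul_sideNormal (hf.ne m) hne
    (hf.re_div_eq_zero_of_isLocalExtr_dist (Or.inr
      (by filter_upwards [Icc_mem_nhds hm.1 hm.2] with u hu using hmax u hu)))
  refine ⟨σ, hσ, fun m' hm' => hf.isSideValue_of_mem_Ioo hm hm' hσ ?_⟩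
  filter_upwards [self_mem_nhdsWithin] with y hy
  refine hf.indexIntegral_eq_zero_of_ray hf.lt.le hf.closed
    (norm_ne_zero_iff.1 ((norm_sideNormal (hf.ne m) hσ).trans_ne one_ne_zero)) fun r hr => ?_
  rintro ⟨u, hu, hur⟩
  have hdist : dist (f u) (f a) = dist (f m) (f a) + y + r := by
    have hsub : f u - f a = (‖f m - f a‖ + y + r : ℝ) * sideNormal f' σ m := by
      push_cast
      linear_combination hur + hnormal
    rw [dist_eq_norm, hsub, norm_mul, norm_sideNormal (hf.ne m) hσ, mul_one, Complex.norm_real,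
      Real.norm_of_nonneg (by have := mem_Ioi.1 hy; positivity), dist_eq_norm]
  linarith [hmax u hu, show 0 < y from hy]

theorem isSideValue_neg_zero (hf : IsSimpleC1Loop f f' a b) (hm : m ∈ Ioo a b) (hσ : |σ| = 1)
    (hk : IsSideValue f f' a b σ m k) (hk0 : k ≠ 0) : IsSideValue f f' a b (-σ) m 0 := by
  obtain ⟨τ, hτ, hzero⟩ := hf.exists_isSideValue_zero
  rcases abs_eq_abs.1 (hσ.trans hτ.symm) with rfl | rfl
  · exact absurd (hk.unique (hzero m hm)) hk0
  · rw [neg_neg]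
    exact hzero m hm

theorem exists_isSideValue_ne_zero (hf : IsSimpleC1Loop f f' a b) :
    ∃ σ : ℝ, |σ| = 1 ∧ ∃ k ≠ 0, ∀ m ∈ Ioo a b, IsSideValue f f' a b σ m k := by
  obtain ⟨σ, hσ, hzero⟩ := hf.exists_isSideValue_zero
  obtain ⟨m, hm⟩ := nonempty_Ioo.2 hf.lt
  obtain ⟨ε, h⟩ := hf.exists_isGraphWindow hm
  have hσ' : |-σ| = 1 := by rwa [abs_neg]
  obtain ⟨k, hk⟩ := hf.exists_eventually_isSideValue hm hσ'
  refine ⟨-σ, hσ', k, fun hk0 => ?_,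
    fun m' hm' => hf.isSideValue_of_mem_Ioo hm hm' hσ' hk.self_of_nhds⟩
  have hjump : (2 * Real.pi * σ : ℝ) * Complex.I = 0 := by
    have hk := hf.eq_of_isSideValue h hσ' hk.self_of_nhds
    have hz := hf.eq_of_isSideValue h hσ (hzero m hm)
    rw [hk0] at hk
    push_cast at hk ⊢
    linear_combination hk - hz
  have hσ0 : σ ≠ 0 := abs_ne_zero.1 (hσ.trans_ne one_ne_zero)
  rw [mul_eq_zero, Complex.ofReal_eq_zero] at hjump
  exact hjump.elim (mul_ne_zero Real.two_pi_pos.ne' hσ0) Complex.I_ne_zero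

end IsSimpleC1Loop

/-! ### Crosscuts -/

/-- `x` is a point of `X` nearest to `c`: the ball around `c` through `x` is inscribed in the
complement of `X` and touches `X` at `x`. -/
structure IsNearestPoint {E : Type*} [PseudoMetricSpace E] (X : Set E) (c x : E) : Prop where
  mem : x ∈ X
  dist_le : ∀ y ∈ X, dist c x ≤ dist c y

namespace IsNearestPoint

variable {E : Type*} [NormedAddCommGroup E] [NormedSpace ℝ E] {X : Set E} {c c' x x' z : E}

theorem notMem_of_mem_segment (hx : IsNearestPoint X c x) (hz : z ∈ segment ℝ c x)
    (hzx : z ≠ x) : z ∉ X := fun hzX => by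
  linarith [dist_add_dist_of_mem_segment hz, hx.dist_le z hzX, dist_pos.2 hzx]

theorem eq_of_mem_segment_of_mem_segment [StrictConvexSpace ℝ E] (hx : IsNearestPoint X c x)
    (hx' : IsNearestPoint X c' x') (hne : x ≠ x') (hz : z ∈ segment ℝ c x)
    (hz' : z ∈ segment ℝ c' x') : z = c := by
  have hsum := dist_add_dist_of_mem_segment hz
  have hsum' := dist_add_dist_of_mem_segment hz'
  have hle := hx.dist_le x' hx'.mem
  have hle' := hx'.dist_le x hx.mem
  have htri := dist_triangle c z x'
  have htri' := dist_triangle c' z x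
  by_contra hzc
  have hbtw : Wbtw ℝ c z x := mem_segment_iff_wbtw.1 hz
  have hbtw' : Wbtw ℝ c z x' := dist_add_dist_eq_iff.1 (by linarith)
  have hray : SameRay ℝ (x - z) (x' - z) := by
    have h₁ : SameRay ℝ (z - c) (x - z) := hbtw.sameRay_vsub
    have h₂ : SameRay ℝ (z - c) (x' - z) := hbtw'.sameRay_vsub
    exact h₁.symm.trans h₂ fun h => absurd (sub_eq_zero.1 h) hzc
  refine hne (sub_left_injective (hray.eq_of_norm_eq ?_))
  rw [← dist_eq_norm, ← dist_eq_norm, dist_comm x, dist_comm x']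
  linarith

theorem disjoint_segment [StrictConvexSpace ℝ E] (hx : IsNearestPoint X c x)
    (hx' : IsNearestPoint X c' x') (hc : c ≠ c') (hne : x ≠ x') :
    Disjoint (segment ℝ c x) (segment ℝ c' x') :=
  Set.disjoint_left.2 fun _ hz hz' => hc ((hx.eq_of_mem_segment_of_mem_segment hx' hne hz hz').symm
    |>.trans (hx'.eq_of_mem_segment_of_mem_segment hx hne.symm hz' hz))

end IsNearestPoint

theorem isC1Curve_lineMap (p q : ℂ) :
    IsC1Curve (AffineMap.lineMap p q : ℝ → ℂ) fun _ => q - p where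
  deriv _ := AffineMap.hasDerivAt_lineMap
  cont := continuous_const

/-- The integral of `dw / (w - z)` along the segment from `p` to `q`. -/
noncomputable def segmentIntegral (p q z : ℂ) : ℂ :=
  indexIntegral (AffineMap.lineMap p q : ℝ → ℂ) (fun _ => q - p) 0 1 z

section segmentIntegral

variable {p q z e : ℂ}

theorem continuousAt_segmentIntegral (hz : z ∉ segment ℝ p q) :
    ContinuousAt (segmentIntegral p q) z :=
  (isC1Curve_lineMap p q).continuousAt_indexIntegral zero_le_one
    (by rwa [← segment_eq_image_lineMap])

theorem exp_segmentIntegral (hz : z ∉ segment ℝ p q) :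
    Complex.exp (segmentIntegral p q z) = (q - z) / (p - z) := by
  rw [segmentIntegral, (isC1Curve_lineMap p q).exp_indexIntegral zero_le_one
    (by rwa [← segment_eq_image_lineMap]), AffineMap.lineMap_apply_one,
    AffineMap.lineMap_apply_zero]

theorem segmentIntegral_eq_log_sub (h : ∀ w ∈ segment ℝ p q, e * (w - z) ∈ Complex.slitPlane) :
    segmentIntegral p q z = Complex.log (e * (q - z)) - Complex.log (e * (p - z)) := by
  rw [segmentIntegral, (isC1Curve_lineMap p q).indexIntegral_eq_log_sub zero_le_one
    fun u hu => h _ (segment_eq_image_lineMap ℝ p q ▸ mem_image_of_mem _ hu),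
    AffineMap.lineMap_apply_one, AffineMap.lineMap_apply_zero]

end segmentIntegral

/-- The broken line from `x` through `c` to `y`. When `x` and `y` are points of a loop nearest to
`c`, it is a crosscut of the loop. -/
def crosscut (x c y : ℂ) : Set ℂ := segment ℝ x c ∪ segment ℝ c y

/-- The integral of `dw / (w - z)` along the crosscut from `x` through `c` to `y`. -/
noncomputable def crosscutIntegral (x c y z : ℂ) : ℂ :=
  segmentIntegral x c z + segmentIntegral c y z

/-- The index integral of the closed curve that runs along `f` from `f s` to `f t` and returns
along the crosscut through `c`. -/
noncomputable def chordIntegral (f f' : ℝ → ℂ) (s t : ℝ) (c z : ℂ) : ℂ :=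
  indexIntegral f f' s t z + crosscutIntegral (f t) c (f s) z

/-- The index integral of the closed curve complementary to that of `chordIntegral`: it runs along
the loop from `f t` through the base to `f s` and returns along the crosscut. -/
noncomputable def cochordIntegral (f f' : ℝ → ℂ) (a b s t : ℝ) (c z : ℂ) : ℂ :=
  indexIntegral f f' a s z + indexIntegral f f' t b z - crosscutIntegral (f t) c (f s) z

section crosscut

variable {x c y z : ℂ}

theorem continuousAt_crosscutIntegral (hz : z ∉ crosscut x c y) :
    ContinuousAt (crosscutIntegral x c y) z :=
  (continuousAt_segmentIntegral fun h => hz (Or.inl h)).add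
    (continuousAt_segmentIntegral fun h => hz (Or.inr h))

theorem exp_crosscutIntegral (hz : z ∉ crosscut x c y) :
    Complex.exp (crosscutIntegral x c y z) = (y - z) / (x - z) := by
  have hc : c - z ≠ 0 := sub_ne_zero.2 fun h => hz (Or.inr (h ▸ left_mem_segment ℝ c y))
  rw [crosscutIntegral, Complex.exp_add, exp_segmentIntegral fun h => hz (Or.inl h),
    exp_segmentIntegral fun h => hz (Or.inr h), mul_comm, div_mul_div_cancel₀ hc]

theorem left_mem_crosscut : x ∈ crosscut x c y := Or.inl (left_mem_segment ℝ x c)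

theorem right_mem_crosscut : y ∈ crosscut x c y := Or.inr (right_mem_segment ℝ c y)

theorem IsNearestPoint.eq_or_eq_of_mem_crosscut {X : Set ℂ} (hx : IsNearestPoint X c x)
    (hy : IsNearestPoint X c y) (hz : z ∈ crosscut x c y) (hzX : z ∈ X) : z = x ∨ z = y := by
  rcases hz with hz | hz
  · exact Or.inl (by_contra fun h => hx.notMem_of_mem_segment (segment_symm ℝ x c ▸ hz) h hzX)
  · exact Or.inr (by_contra fun h => hy.notMem_of_mem_segment hz h hzX)

theorem IsNearestPoint.disjoint_segment_crosscut {X : Set ℂ} {c' w : ℂ}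
    (hw : IsNearestPoint X c' w) (hx : IsNearestPoint X c x) (hy : IsNearestPoint X c y)
    (hc : c' ≠ c) (hwx : w ≠ x) (hwy : w ≠ y) : Disjoint (segment ℝ c' w) (crosscut x c y) := by
  rw [crosscut, segment_symm ℝ x c]
  exact (hw.disjoint_segment hx hc hwx).union_right (hw.disjoint_segment hy hc hwy)

end crosscut

theorem IsC1Curve.chordIntegral_eq_of_isPreconnected {f f' : ℝ → ℂ} {s t : ℝ} {c z w : ℂ}
    (hf : IsC1Curve f f') (hst : s ≤ t) {S : Set ℂ} (hS : IsPreconnected S)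
    (harc : Disjoint S (f '' Icc s t)) (hcross : Disjoint S (crosscut (f t) c (f s)))
    (hz : z ∈ S) (hw : w ∈ S) : chordIntegral f f' s t c z = chordIntegral f f' s t c w := by
  rw [Set.disjoint_left] at harc hcross
  refine eq_of_isPreconnected_of_exp_eq_one (g := chordIntegral f f' s t c) hS
    (fun v hv => ((hf.continuousAt_indexIntegral hst (harc hv)).add
      (continuousAt_crosscutIntegral (hcross hv))).continuousWithinAt) (fun v hv => ?_) hz hw
  have hs : f s - v ≠ 0 := sub_ne_zero.2 fun h => hcross hv (h ▸ right_mem_crosscut)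
  have ht : f t - v ≠ 0 := sub_ne_zero.2 fun h => hcross hv (h ▸ left_mem_crosscut)
  rw [chordIntegral, Complex.exp_add, hf.exp_indexIntegral hst (harc hv),
    exp_crosscutIntegral (hcross hv), div_mul_div_cancel₀ hs, div_self ht]

namespace IsSimpleC1Loop

variable {f f' : ℝ → ℂ} {a b s t : ℝ} {c z w : ℂ}

theorem cochordIntegral_eq_of_isPreconnected (hf : IsSimpleC1Loop f f' a b) (has : a ≤ s)
    (htb : t ≤ b) {S : Set ℂ} (hS : IsPreconnected S)
    (harc : Disjoint S (f '' Icc a s ∪ f '' Icc t b))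
    (hcross : Disjoint S (crosscut (f t) c (f s))) (hz : z ∈ S) (hw : w ∈ S) :
    cochordIntegral f f' a b s t c z = cochordIntegral f f' a b s t c w := by
  rw [Set.disjoint_union_right, Set.disjoint_left, Set.disjoint_left] at harc
  rw [Set.disjoint_left] at hcross
  refine eq_of_isPreconnected_of_exp_eq_one (g := cochordIntegral f f' a b s t c) hS
    (fun v hv => (((hf.continuousAt_indexIntegral has (harc.1 hv)).add
      (hf.continuousAt_indexIntegral htb (harc.2 hv))).sub
      (continuousAt_crosscutIntegral (hcross hv))).continuousWithinAt) (fun v hv => ?_) hz hw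
  have ha : f a - v ≠ 0 := sub_ne_zero.2 fun h => harc.1 hv ⟨a, left_mem_Icc.2 has, h⟩
  have hs : f s - v ≠ 0 := sub_ne_zero.2 fun h => hcross hv (h ▸ right_mem_crosscut)
  have ht : f t - v ≠ 0 := sub_ne_zero.2 fun h => hcross hv (h ▸ left_mem_crosscut)
  rw [cochordIntegral, Complex.exp_sub, Complex.exp_add, hf.exp_indexIntegral has (harc.1 hv),
    hf.exp_indexIntegral htb (harc.2 hv), exp_crosscutIntegral (hcross hv), ← hf.closed]
  field_simp

theorem chordIntegral_add_cochordIntegral (hf : IsSimpleC1Loop f f' a b) (has : a ≤ s)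
    (hst : s ≤ t) (htb : t ≤ b) (hz : z ∉ f '' Icc a b) :
    chordIntegral f f' s t c z + cochordIntegral f f' a b s t c z = indexIntegral f f' a b z := by
  rw [← hf.indexIntegral_add (has.trans hst) htb hz, ← hf.indexIntegral_add has hst
    fun h => hz (image_mono (Icc_subset_Icc_right htb) h), chordIntegral, cochordIntegral]
  ring

theorem isPreconnected_image_diff (hf : IsSimpleC1Loop f f' a b) (hs : s ∈ Ioo a b) (hst : s ≤ t)
    (htb : t ≤ b) : IsPreconnected (f '' Icc a b \ f '' Icc s t) := by
  rcases htb.lt_or_eq with htb | rfl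
  · suffices h : f '' Icc a b \ f '' Icc s t = f '' Ico a s ∪ f '' Ioc t b from
      h ▸ IsPreconnected.union (f a) ⟨a, ⟨le_rfl, hs.1⟩, rfl⟩ ⟨b, ⟨htb, le_rfl⟩, hf.closed.symm⟩
        (isPreconnected_Ico.image f hf.continuous.continuousOn)
        (isPreconnected_Ioc.image f hf.continuous.continuousOn)
    have harc : Icc a b \ Icc s t = Ico a s ∪ Ioc t b := by grind
    rw [← image_union, ← harc]
    refine Subset.antisymm ?_ ?_
    · rintro _ ⟨⟨u, hu, rfl⟩, hust⟩
      exact mem_image_of_mem f ⟨hu, fun h => hust (mem_image_of_mem f h)⟩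
    · rintro _ ⟨u, ⟨hu, hust⟩, rfl⟩
      refine ⟨mem_image_of_mem f hu, fun ⟨v, hv, hvu⟩ => hust ?_⟩
      rwa [hf.eq_of_eq ⟨hs.1.trans_le hv.1, hv.2.trans_lt htb⟩ hu hvu.symm]
  · suffices h : f '' Icc a t \ f '' Icc s t = f '' Ioo a s from
      h ▸ isPreconnected_Ioo.image f hf.continuous.continuousOn
    refine Subset.antisymm ?_ ?_
    · rintro _ ⟨⟨u, hu, rfl⟩, hus⟩
      refine ⟨u, ⟨hu.1.lt_of_ne ?_, not_le.1 fun h => hus ⟨u, ⟨h, hu.2⟩, rfl⟩⟩, rfl⟩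
      rintro rfl
      exact hus ⟨t, ⟨hst, le_rfl⟩, hf.closed.symm⟩
    · rintro _ ⟨u, hu, rfl⟩
      exact ⟨mem_image_of_mem f ⟨hu.1.le, hu.2.le.trans hst⟩,
        hf.notMem_image ⟨hu.1, hu.2.trans hs.2⟩ hs.1.le le_rfl fun h => hu.2.not_ge h.1⟩

end IsSimpleC1Loop

/-! ### Bitangent discs -/

/-- A disc with centre `c`, inscribed in the loop on the side where its index integral does not
vanish, that touches the loop at the inner time `s` and again at the time `t`. -/
structure IsBitangent (f f' : ℝ → ℂ) (a b s t : ℝ) (c : ℂ) : Prop where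
  left_mem : s ∈ Ioo a b
  right_mem : t ∈ Icc a b
  ne : t ≠ s
  nearest_left : IsNearestPoint (f '' Icc a b) c (f s)
  nearest_right : IsNearestPoint (f '' Icc a b) c (f t)
  center_notMem : c ∉ f '' Icc a b
  index_ne : indexIntegral f f' a b c ≠ 0

namespace IsSimpleC1Loop

variable {f f' : ℝ → ℂ} {a b s σ R : ℝ} {c : ℂ}

theorem re_div_eq_zero_of_isNearestPoint (hf : IsSimpleC1Loop f f' a b) (hs : s ∈ Ioo a b)
    (h : IsNearestPoint (f '' Icc a b) c (f s)) : ((c - f s) / f' s).re = 0 := by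
  rw [← neg_sub, neg_div, Complex.neg_re, hf.re_div_eq_zero_of_isLocalExtr_dist (Or.inl ?_),
    neg_zero]
  filter_upwards [Icc_mem_nhds hs.1 hs.2] with u hu
  simpa only [dist_comm c] using h.dist_le _ (mem_image_of_mem f hu)

theorem isSideValue_of_isNearestPoint (hf : IsSimpleC1Loop f f' a b) (hσ : |σ| = 1) (hR : 0 < R)
    (h : IsNearestPoint (f '' Icc a b) (f s + R * sideNormal f' σ s) (f s)) :
    IsSideValue f f' a b σ s (indexIntegral f f' a b (f s + R * sideNormal f' σ s)) := by
  have hnormal : sideNormal f' σ s ≠ 0 :=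
    norm_ne_zero_iff.1 ((norm_sideNormal (hf.ne s) hσ).trans_ne one_ne_zero)
  have hcont : Continuous fun y : ℝ => f s + y * sideNormal f' σ s := by fun_prop
  filter_upwards [Ioo_mem_nhdsGT hR] with y hy
  refine hf.indexIntegral_eq_of_isPreconnected (isPreconnected_Ioc.image _ hcont.continuousOn)
    ?_ ⟨y, ⟨hy.1, hy.2.le⟩, rfl⟩ ⟨R, ⟨hR, le_rfl⟩, rfl⟩
  rintro _ ⟨r, hr, rfl⟩
  refine h.notMem_of_mem_segment ?_ fun hr0 => ?_
  · rw [segment_symm, segment_eq_image']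
    refine ⟨r / R, ⟨div_nonneg hr.1.le hR.le, (div_le_one hR).2 hr.2⟩, ?_⟩
    have : (R : ℂ) ≠ 0 := by exact_mod_cast hR.ne'
    simp only [Complex.real_smul, Complex.ofReal_div]
    field_simp
    ring
  · rw [add_eq_left, mul_eq_zero, Complex.ofReal_eq_zero] at hr0
    exact hr0.elim hr.1.ne' hnormal

end IsSimpleC1Loop

namespace IsBitangent

variable {f f' : ℝ → ℂ} {a b s t ε : ℝ} {c w z : ℂ}

theorem right_ne_left (h : IsBitangent f f' a b s t c) (hf : IsSimpleC1Loop f f' a b) :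
    f t ≠ f s :=
  fun hts => h.ne (hf.eq_of_eq h.left_mem h.right_mem hts)

theorem exists_isSideValue_neg_zero (h : IsBitangent f f' a b s t c)
    (hf : IsSimpleC1Loop f f' a b) : ∃ σ : ℝ, |σ| = 1 ∧ IsSideValue f f' a b (-σ) s 0 ∧
      ∃ r : ℝ, 0 < r ∧ (c - f s) / f' s = σ * Complex.I * r := by
  have hne : c - f s ≠ 0 := sub_ne_zero.2 fun hc => h.center_notMem (hc ▸ h.nearest_left.mem)
  obtain ⟨σ, hσ, hc⟩ := exists_eq_mul_sideNormal (hf.ne s) hne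
    (hf.re_div_eq_zero_of_isNearestPoint h.left_mem h.nearest_left)
  have hc' := sub_eq_iff_eq_add'.1 hc
  have hside := hf.isSideValue_of_isNearestPoint hσ (norm_pos_iff.2 hne) (hc' ▸ h.nearest_left)
  refine ⟨σ, hσ, hf.isSideValue_neg_zero h.left_mem hσ hside (hc' ▸ h.index_ne),
    ‖c - f s‖ / ‖f' s‖, div_pos (norm_pos_iff.2 hne) (norm_pos_iff.2 (hf.ne s)), ?_⟩
  have := hf.ne s
  nth_rw 1 [hc, sideNormal]
  push_cast
  field_simp

theorem re_sub_div_eq_zero_of_mem_segment (h : IsBitangent f f' a b s t c)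
    (hf : IsSimpleC1Loop f f' a b) (hw : w ∈ segment ℝ c (f s)) :
    ((w - f s) / f' s).re = 0 := by
  rw [segment_symm, segment_eq_image'] at hw
  obtain ⟨r, -, rfl⟩ := hw
  rw [add_sub_cancel_left, smul_div_assoc, Complex.smul_re,
    hf.re_div_eq_zero_of_isNearestPoint h.left_mem h.nearest_left, smul_zero]

theorem notMem_segment (h : IsBitangent f f' a b s t c) (hf : IsSimpleC1Loop f f' a b) :
    f s ∉ segment ℝ (f t) c := fun hs =>
  h.nearest_right.notMem_of_mem_segment (segment_symm ℝ (f t) c ▸ hs) (h.right_ne_left hf).symm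
    h.nearest_left.mem

/-- The logarithms of `z - f s` coming from the loop and from the crosscut cancel: the closed curve
turns by less than a half-turn at its corner. -/
theorem chordIntegral_eq (h : IsBitangent f f' a b s t c) (hf : IsSimpleC1Loop f f' a b)
    (hw : IsGraphWindow f f' a b s ε) (hεt : s + ε ≤ t) {u : ℝ} (hu : u ∈ Ioo (s - ε) s) :
    chordIntegral f f' s t c (f u) = indexIntegral f f' (s + ε) t (f u) +
      segmentIntegral (f t) c (f u) + (Complex.log ((f' s)⁻¹ * (f (s + ε) - f u)) -
        Complex.log ((f' s)⁻¹ * (c - f u))) := by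
  have hε := hw.pos
  have harc : ∀ v ∈ Icc s (s + ε), (f' s)⁻¹ * (f v - f u) ∈ Complex.slitPlane := fun v hv => by
    rw [inv_mul_eq_div]
    exact Or.inl (hw.re_pos hu.1.le (hu.2.trans_le hv.1) hv.2)
  have hcross : ∀ w ∈ segment ℝ c (f s), (f' s)⁻¹ * (w - f u) ∈ Complex.slitPlane := fun w hws => by
    rw [inv_mul_eq_div, ← sub_add_sub_cancel w (f s), add_div]
    refine Or.inl ?_
    rw [Complex.add_re, h.re_sub_div_eq_zero_of_mem_segment hf hws, zero_add]
    exact hw.re_pos hu.1.le hu.2 (by linarith)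
  have hu' : u ∈ Ioo a b := ⟨by linarith [hu.1, hw.left_le], by linarith [hu.2, h.left_mem.2]⟩
  rw [chordIntegral, crosscutIntegral, ← hf.indexIntegral_add (by linarith) hεt
    (hf.notMem_image hu' h.left_mem.1.le h.right_mem.2 fun hst => hu.2.not_ge hst.1),
    hf.indexIntegral_eq_log_sub (by linarith) harc, segmentIntegral_eq_log_sub hcross]
  ring

theorem cochordIntegral_eq (h : IsBitangent f f' a b s t c) (hf : IsSimpleC1Loop f f' a b)
    (hw : IsGraphWindow f f' a b s ε) (hεt : s + ε ≤ t) {v : ℝ} (hv : v ∈ Ioo s (s + ε)) :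
    cochordIntegral f f' a b s t c (f v) = indexIntegral f f' a (s - ε) (f v) +
      indexIntegral f f' t b (f v) - segmentIntegral (f t) c (f v) -
      (Complex.log ((-f' s)⁻¹ * (f (s - ε) - f v)) - Complex.log ((-f' s)⁻¹ * (c - f v))) := by
  have hε := hw.pos
  have harc : ∀ u ∈ Icc (s - ε) s, (-f' s)⁻¹ * (f u - f v) ∈ Complex.slitPlane := fun u hu => by
    rw [inv_mul_eq_div, ← neg_sub, neg_div_neg_eq]
    exact Or.inl (hw.re_pos hu.1 (hu.2.trans_lt hv.1) hv.2.le)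
  have hcross : ∀ w ∈ segment ℝ c (f s), (-f' s)⁻¹ * (w - f v) ∈ Complex.slitPlane :=
    fun w hws => by
      rw [inv_mul_eq_div, ← sub_sub_sub_cancel_right w (f v) (f s), ← neg_sub, neg_div_neg_eq,
        sub_div]
      refine Or.inl ?_
      rw [Complex.sub_re, h.re_sub_div_eq_zero_of_mem_segment hf hws, sub_zero]
      exact hw.re_pos (by linarith) hv.1 hv.2.le
  have hv' : v ∈ Ioo a b := ⟨h.left_mem.1.trans hv.1, by linarith [hv.2, h.right_mem.2]⟩
  rw [cochordIntegral, crosscutIntegral, ← hf.indexIntegral_add hw.left_le (by linarith)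
    (hf.notMem_image hv' le_rfl h.left_mem.2.le fun hst => hv.1.not_ge hst.2),
    hf.indexIntegral_eq_log_sub (by linarith) harc, segmentIntegral_eq_log_sub hcross]
  ring

theorem chordIntegral_eq_of_mem_diff (h : IsBitangent f f' a b s t c)
    (hf : IsSimpleC1Loop f f' a b) (hst : s < t) (hz : z ∈ f '' Icc a b \ f '' Icc s t)
    (hw : w ∈ f '' Icc a b \ f '' Icc s t) :
    chordIntegral f f' s t c z = chordIntegral f f' s t c w := by
  refine hf.chordIntegral_eq_of_isPreconnected hst.le
    (hf.isPreconnected_image_diff h.left_mem hst.le h.right_mem.2) disjoint_sdiff_left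
    (Set.disjoint_left.2 fun v hv hvc => hv.2 ?_) hz hw
  rcases h.nearest_right.eq_or_eq_of_mem_crosscut h.nearest_left hvc hv.1 with rfl | rfl
  · exact mem_image_of_mem f (right_mem_Icc.2 hst.le)
  · exact mem_image_of_mem f (left_mem_Icc.2 hst.le)

theorem cochordIntegral_eq_of_mem_Ioo (h : IsBitangent f f' a b s t c)
    (hf : IsSimpleC1Loop f f' a b) {u v : ℝ} (hu : u ∈ Ioo s t) (hv : v ∈ Ioo s t) :
    cochordIntegral f f' a b s t c (f u) = cochordIntegral f f' a b s t c (f v) := by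
  have hoff : ∀ x ∈ Ioo s t, f x ∉ f '' Icc a s ∪ f '' Icc t b := fun x hx => by
    have hx' : x ∈ Ioo a b := ⟨h.left_mem.1.trans hx.1, hx.2.trans_le h.right_mem.2⟩
    exact not_or.2 ⟨hf.notMem_image hx' le_rfl h.left_mem.2.le fun hxs => hx.1.not_ge hxs.2,
      hf.notMem_image hx' h.right_mem.1 le_rfl fun hxt => hx.2.not_ge hxt.1⟩
  refine hf.cochordIntegral_eq_of_isPreconnected h.left_mem.1.le h.right_mem.2
    (isPreconnected_Ioo.image f hf.continuous.continuousOn)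
    (Set.disjoint_left.2 (forall_mem_image.2 hoff))
    (Set.disjoint_left.2 (forall_mem_image.2 fun x hx hxc => hoff x hx ?_))
    (mem_image_of_mem f hu) (mem_image_of_mem f hv)
  have hxΓ : f x ∈ f '' Icc a b :=
    ⟨x, ⟨h.left_mem.1.le.trans hx.1.le, hx.2.le.trans h.right_mem.2⟩, rfl⟩
  rcases h.nearest_right.eq_or_eq_of_mem_crosscut h.nearest_left hxc hxΓ with hxt | hxs
  · exact Or.inr ⟨t, left_mem_Icc.2 h.right_mem.2, hxt.symm⟩
  · exact Or.inl ⟨s, right_mem_Icc.2 h.left_mem.1.le, hxs.symm⟩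

theorem chordIntegral_eq_of_isGraphWindow (h : IsBitangent f f' a b s t c)
    (hf : IsSimpleC1Loop f f' a b) (hw : IsGraphWindow f f' a b s ε) (hεt : s + ε ≤ t)
    (hz : z ∈ f '' Icc a b \ f '' Icc s t) :
    chordIntegral f f' s t c z = indexIntegral f f' (s + ε) t (f s) +
      segmentIntegral (f t) c (f s) + (Complex.log ((f' s)⁻¹ * (f (s + ε) - f s)) -
        Complex.log ((f' s)⁻¹ * (c - f s))) := by
  have hε := hw.pos
  have harc : (f' s)⁻¹ * (f (s + ε) - f s) ∈ Complex.slitPlane := by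
    rw [inv_mul_eq_div]
    exact Or.inl (hw.re_pos (by linarith) (by linarith) le_rfl)
  have hcenter : (f' s)⁻¹ * (c - f s) ∈ Complex.slitPlane := by
    obtain ⟨σ, hσ, -, r, hr, hc⟩ := h.exists_isSideValue_neg_zero hf
    rw [inv_mul_eq_div, hc]
    exact mul_I_mul_mem_slitPlane hσ (by simpa using hr.ne')
  have hcont : ContinuousAt (fun w => indexIntegral f f' (s + ε) t w + segmentIntegral (f t) c w +
      (Complex.log ((f' s)⁻¹ * (f (s + ε) - w)) - Complex.log ((f' s)⁻¹ * (c - w)))) (f s) :=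
    ((hf.continuousAt_indexIntegral hεt (hf.notMem_image h.left_mem (by linarith [hw.left_le])
      h.right_mem.2 fun hs => by linarith [hs.1])).add
      (continuousAt_segmentIntegral (h.notMem_segment hf))).add
      (((continuousAt_const.mul (continuousAt_const.sub continuousAt_id)).clog harc).sub
        ((continuousAt_const.mul (continuousAt_const.sub continuousAt_id)).clog hcenter))
  have hlim := hcont.tendsto.comp
    (hf.continuous.continuousAt.tendsto.mono_left (nhdsWithin_le_nhds (s := Iio s)))
  refine tendsto_nhds_unique (tendsto_const_nhds.congr' ?_) hlim
  filter_upwards [Ioo_mem_nhdsLT (sub_lt_self s hε)] with u hu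
  have hu' : u ∈ Ioo a b := ⟨by linarith [hu.1, hw.left_le], by linarith [hu.2, h.left_mem.2]⟩
  rw [Function.comp_apply, ← h.chordIntegral_eq hf hw hεt hu]
  exact h.chordIntegral_eq_of_mem_diff hf (by linarith) hz ⟨⟨u, Ioo_subset_Icc_self hu', rfl⟩,
    hf.notMem_image hu' h.left_mem.1.le h.right_mem.2 fun hst => hu.2.not_ge hst.1⟩

theorem cochordIntegral_eq_of_isGraphWindow (h : IsBitangent f f' a b s t c)
    (hf : IsSimpleC1Loop f f' a b) (hw : IsGraphWindow f f' a b s ε) (hεt : s + ε ≤ t)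
    {m : ℝ} (hm : m ∈ Ioo s t) :
    cochordIntegral f f' a b s t c (f m) = indexIntegral f f' a (s - ε) (f s) +
      indexIntegral f f' t b (f s) - segmentIntegral (f t) c (f s) -
      (Complex.log ((-f' s)⁻¹ * (f (s - ε) - f s)) - Complex.log ((-f' s)⁻¹ * (c - f s))) := by
  have hε := hw.pos
  have harc : (-f' s)⁻¹ * (f (s - ε) - f s) ∈ Complex.slitPlane := by
    rw [inv_mul_eq_div, ← neg_sub, neg_div_neg_eq]
    exact Or.inl (hw.re_pos le_rfl (by linarith) (by linarith))
  have hcenter : (-f' s)⁻¹ * (c - f s) ∈ Complex.slitPlane := by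
    obtain ⟨σ, hσ, -, r, hr, hc⟩ := h.exists_isSideValue_neg_zero hf
    rw [inv_mul_eq_div, div_neg, hc, ← mul_neg]
    exact mul_I_mul_mem_slitPlane hσ (by simpa using hr.ne')
  have hcont : ContinuousAt (fun w => indexIntegral f f' a (s - ε) w + indexIntegral f f' t b w -
      segmentIntegral (f t) c w - (Complex.log ((-f' s)⁻¹ * (f (s - ε) - w)) -
        Complex.log ((-f' s)⁻¹ * (c - w)))) (f s) :=
    (((hf.continuousAt_indexIntegral hw.left_le (hf.notMem_image h.left_mem le_rfl
      (by linarith [hw.le_right]) fun hs => by linarith [hs.2])).add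
      (hf.continuousAt_indexIntegral h.right_mem.2 (hf.notMem_image h.left_mem h.right_mem.1
        le_rfl fun hs => by linarith [hs.1]))).sub
      (continuousAt_segmentIntegral (h.notMem_segment hf))).sub
      (((continuousAt_const.mul (continuousAt_const.sub continuousAt_id)).clog harc).sub
        ((continuousAt_const.mul (continuousAt_const.sub continuousAt_id)).clog hcenter))
  have hlim := hcont.tendsto.comp
    (hf.continuous.continuousAt.tendsto.mono_left (nhdsWithin_le_nhds (s := Ioi s)))
  refine tendsto_nhds_unique (tendsto_const_nhds.congr' ?_) hlim
  filter_upwards [Ioo_mem_nhdsGT (lt_add_of_pos_right s hε)] with v hv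
  rw [Function.comp_apply, ← h.cochordIntegral_eq hf hw hεt hv]
  exact h.cochordIntegral_eq_of_mem_Ioo hf hm ⟨hv.1, hv.2.trans_le hεt⟩

/-- Both integrals are evaluated at the corner `f s`, from the two sides of the crosscut. Their sum
there is the side value on the side of `f s` opposite to the crosscut. -/
theorem chordIntegral_add_cochordIntegral_eq_zero (h : IsBitangent f f' a b s t c)
    (hf : IsSimpleC1Loop f f' a b) {m : ℝ} (hm : m ∈ Ioo s t)
    (hz : z ∈ f '' Icc a b \ f '' Icc s t) :
    chordIntegral f f' s t c z + cochordIntegral f f' a b s t c (f m) = 0 := by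
  obtain ⟨ε₀, hw₀⟩ := hf.exists_isGraphWindow h.left_mem
  set ε := min ε₀ (t - s)
  have hst : s < t := hm.1.trans hm.2
  have hw := hw₀.mono (lt_min hw₀.pos (sub_pos.2 hst)) (min_le_left _ _)
  have hεt : s + ε ≤ t := by linarith [min_le_right ε₀ (t - s)]
  obtain ⟨σ, hσ, hside, r, hr, hc⟩ := h.exists_isSideValue_neg_zero hf
  have hσ' : |-σ| = 1 := by rwa [abs_neg]
  have hzero := hf.eq_of_isSideValue hw hσ' hside
  have hr' : 0 < (r : ℂ).re := hr
  have hflip : (-f' s)⁻¹ * (f (s - ε) - f s) = (f s - f (s - ε)) / f' s := by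
    rw [inv_mul_eq_div, ← neg_sub, neg_div_neg_eq]
  have hc' : (-f' s)⁻¹ * (c - f s) = (-σ : ℝ) * Complex.I * r := by
    rw [inv_mul_eq_div, div_neg, hc]
    push_cast
    ring
  rw [h.chordIntegral_eq_of_isGraphWindow hf hw hεt hz,
    h.cochordIntegral_eq_of_isGraphWindow hf hw hεt hm, hflip, hc', log_mul_I_of_re_pos hσ' hr',
    inv_mul_eq_div, inv_mul_eq_div, hc, log_mul_I_of_re_pos hσ hr']
  rw [principalValue, ← hf.indexIntegral_add hεt h.right_mem.2 (hf.notMem_image h.left_mem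
    (by linarith [hw.left_le, hw.pos]) le_rfl fun hs => by linarith [hs.1, hw.pos])] at hzero
  push_cast at hzero ⊢
  linear_combination -hzero

theorem mem_image_Icc_of_mem_Ioo (h : IsBitangent f f' a b s t c) (hf : IsSimpleC1Loop f f' a b)
    {m n : ℝ} {c' : ℂ} (h' : IsBitangent f f' a b m n c') (hm : m ∈ Ioo s t) (hcc' : c' ≠ c) :
    f n ∈ f '' Icc s t := by
  by_contra hn
  have hst : s < t := hm.1.trans hm.2
  have hms : f m ≠ f s := fun heq =>
    hm.1.ne' (hf.eq_of_eq h.left_mem (Ioo_subset_Icc_self h'.left_mem) heq)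
  have hmt : f m ≠ f t := fun heq => hm.2.ne' (hf.eq_of_eq h'.left_mem h.right_mem heq.symm)
  have hns : f n ≠ f s := fun heq => hn (heq ▸ mem_image_of_mem f (left_mem_Icc.2 hst.le))
  have hnt : f n ≠ f t := fun heq => hn (heq ▸ mem_image_of_mem f (right_mem_Icc.2 hst.le))
  have hchord : chordIntegral f f' s t c c' = chordIntegral f f' s t c (f n) := by
    refine hf.chordIntegral_eq_of_isPreconnected hst.le (convex_segment _ _).isPreconnected
      (Set.disjoint_left.2 fun z hz hzst => ?_)
      (h'.nearest_right.disjoint_segment_crosscut h.nearest_right h.nearest_left hcc' hnt hns)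
      (left_mem_segment ℝ c' (f n)) (right_mem_segment ℝ c' (f n))
    refine h'.nearest_right.notMem_of_mem_segment hz (fun hzn => hn (hzn ▸ hzst))
      (image_mono (Icc_subset_Icc h.left_mem.1.le h.right_mem.2) hzst)
  have hcochord : cochordIntegral f f' a b s t c c' = cochordIntegral f f' a b s t c (f m) := by
    refine hf.cochordIntegral_eq_of_isPreconnected h.left_mem.1.le h.right_mem.2
      (convex_segment _ _).isPreconnected (Set.disjoint_left.2 fun z hz hzΓ => ?_)
      (h'.nearest_left.disjoint_segment_crosscut h.nearest_right h.nearest_left hcc' hmt hms)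
      (left_mem_segment ℝ c' (f m)) (right_mem_segment ℝ c' (f m))
    rw [← image_union] at hzΓ
    obtain ⟨u, hu, rfl⟩ := hzΓ
    have huab : u ∈ Icc a b := hu.elim (fun hu => ⟨hu.1, hu.2.trans h.left_mem.2.le⟩)
      fun hu => ⟨h.right_mem.1.trans hu.1, hu.2⟩
    refine h'.nearest_left.notMem_of_mem_segment hz (fun hum => ?_) (mem_image_of_mem f huab)
    rw [hf.eq_of_eq h'.left_mem huab hum] at hu
    exact hu.elim (fun hu => hm.1.not_ge hu.2) fun hu => hm.2.not_ge hu.1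
  refine h'.index_ne ?_
  rw [← hf.chordIntegral_add_cochordIntegral (c := c) h.left_mem.1.le hst.le h.right_mem.2
    h'.center_notMem, hchord, hcochord]
  exact h.chordIntegral_add_cochordIntegral_eq_zero hf hm ⟨h'.nearest_right.mem, hn⟩

end IsBitangent

namespace IsSimpleC1Loop

variable {f f' : ℝ → ℂ} {a b : ℝ}

theorem reverse (hf : IsSimpleC1Loop f f' a b) :
    IsSimpleC1Loop (fun u => f (a + b - u)) (fun u => -f' (a + b - u)) a b where
  deriv u := by
    simpa using (hf.deriv (a + b - u)).comp_const_sub (a + b) u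
  cont := (hf.cont.comp (by fun_prop)).neg
  lt := hf.lt
  ne u := neg_ne_zero.2 (hf.ne _)
  closed := by simpa using hf.closed.symm
  inj := by
    intro x hx y hy h
    have hx' : a + b - x ∈ Icc a b := ⟨by linarith [hx.2], by linarith [hx.1]⟩
    have hy' : a + b - y ∈ Icc a b := ⟨by linarith [hy.2], by linarith [hy.1]⟩
    rcases hx.1.eq_or_lt with rfl | hxa
    · rcases hy.1.eq_or_lt with rfl | hya
      · rfl
      · linarith [hf.eq_of_eq ⟨by linarith [hy.2], by linarith⟩ hx' h]
    · linarith [hf.eq_of_eq ⟨by linarith [hx.2], by linarith⟩ hy' h.symm]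

end IsSimpleC1Loop

theorem indexIntegral_reverse (f f' : ℝ → ℂ) (a b : ℝ) (z : ℂ) :
    indexIntegral (fun u => f (a + b - u)) (fun u => -f' (a + b - u)) a b z =
      -indexIntegral f f' a b z := by
  simpa [indexIntegral, neg_div] using intervalIntegral.integral_comp_sub_left
    (a := a) (b := b) (fun u => -(f' u / (f u - z))) (a + b)

theorem image_reverse (f : ℝ → ℂ) (a b s t : ℝ) :
    (fun u => f (a + b - u)) '' Icc s t = f '' Icc (a + b - t) (a + b - s) := by
  rw [← image_image f (fun u => a + b - u), image_const_sub_Icc]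

namespace IsBitangent

variable {f f' : ℝ → ℂ} {a b s t m n : ℝ} {c c' : ℂ}

theorem reverse (h : IsBitangent f f' a b s t c) :
    IsBitangent (fun u => f (a + b - u)) (fun u => -f' (a + b - u)) a b (a + b - s) (a + b - t)
      c := by
  have himage : (fun u => f (a + b - u)) '' Icc a b = f '' Icc a b := by
    rw [image_reverse, add_sub_cancel_right, add_sub_cancel_left]
  refine ⟨⟨by linarith [h.left_mem.2], by linarith [h.left_mem.1]⟩,
    ⟨by linarith [h.right_mem.2], by linarith [h.right_mem.1]⟩, fun hts => h.ne (by linarith),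
    ?_, ?_, himage ▸ h.center_notMem, ?_⟩
  · simpa only [himage, sub_sub_cancel] using h.nearest_left
  · simpa only [himage, sub_sub_cancel] using h.nearest_right
  · rw [indexIntegral_reverse]
    exact neg_ne_zero.2 h.index_ne

theorem mem_image_uIcc_of_mem_uIoo (h : IsBitangent f f' a b s t c)
    (hf : IsSimpleC1Loop f f' a b) (h' : IsBitangent f f' a b m n c') (hm : m ∈ uIoo s t)
    (hcc' : c' ≠ c) : f n ∈ f '' uIcc s t := by
  rcases le_total s t with hst | hts
  · rw [uIoo_of_le hst] at hm
    rw [uIcc_of_le hst]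
    exact h.mem_image_Icc_of_mem_Ioo hf h' hm hcc'
  · rw [uIoo_of_ge hts] at hm
    rw [uIcc_of_ge hts]
    have hmem := h.reverse.mem_image_Icc_of_mem_Ioo hf.reverse h'.reverse
      ⟨by linarith [hm.2], by linarith [hm.1]⟩ hcc'
    simpa only [image_reverse, sub_sub_cancel] using hmem

theorem exists_isBitangent_abs_sub_le (h : IsBitangent f f' a b s t c)
    (hf : IsSimpleC1Loop f f' a b) (h' : IsBitangent f f' a b ((s + t) / 2) n c') :
    ∃ n', IsBitangent f f' a b ((s + t) / 2) n' c' ∧ |n' - (s + t) / 2| ≤ |t - s| / 2 := by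
  have htwo : |t - s| / 2 = |(t - s) / 2| := by rw [abs_div, abs_two]
  rw [htwo]
  rcases eq_or_ne c' c with rfl | hcc'
  · refine ⟨t, ⟨h'.left_mem, h.right_mem, fun ht => h.ne (by linarith), h'.nearest_left,
      h.nearest_right, h.center_notMem, h.index_ne⟩, (congrArg abs (by ring)).le⟩
  · have hm : (s + t) / 2 ∈ uIoo s t := by
      rcases h.ne.lt_or_gt with hts | hst
      · rw [uIoo_of_gt hts]
        constructor <;> linarith
      · rw [uIoo_of_lt hst]
        constructor <;> linarith
    obtain ⟨n', hn', hfn⟩ := h.mem_image_uIcc_of_mem_uIoo hf h' hm hcc'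
    refine ⟨n', ⟨h'.left_mem, uIcc_subset_Icc (Ioo_subset_Icc_self h.left_mem) h.right_mem hn',
      ?_, h'.nearest_left, hfn ▸ h'.nearest_right, h'.center_notMem, h'.index_ne⟩, ?_⟩
    · rintro rfl
      exact h'.right_ne_left hf hfn.symm
    · rw [abs_le, ← htwo]
      rcases le_total s t with hst | hts
      · rw [uIcc_of_le hst] at hn'
        rw [abs_of_nonneg (sub_nonneg.2 hst)]
        constructor <;> linarith [hn'.1, hn'.2]
      · rw [uIcc_of_ge hts] at hn'
        rw [abs_of_nonpos (sub_nonpos.2 hts)]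
        constructor <;> linarith [hn'.1, hn'.2]

end IsBitangent

section TangentBall

variable {E : Type*} [NormedAddCommGroup E] [InnerProductSpace ℝ E] {x y N : E} {R r : ℝ}

theorem le_dist_add_smul_iff (hR : 0 ≤ R) (hN : ‖N‖ = 1) :
    R ≤ dist (x + R • N) y ↔ R * (2 * inner ℝ (y - x) N) ≤ ‖y - x‖ ^ 2 := by
  rw [dist_comm, dist_eq_norm, ← sub_sub, ← sq_le_sq₀ hR (norm_nonneg _), norm_sub_sq_real,
    inner_smul_right, norm_smul, hN, mul_one, Real.norm_of_nonneg hR]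
  constructor <;> intro h <;> linarith

theorem dist_add_smul_eq_iff (hR : 0 ≤ R) (hN : ‖N‖ = 1) :
    dist (x + R • N) y = R ↔ R * (2 * inner ℝ (y - x) N) = ‖y - x‖ ^ 2 := by
  rw [dist_comm, dist_eq_norm, ← sub_sub, ← sq_eq_sq₀ (norm_nonneg _) hR, norm_sub_sq_real,
    inner_smul_right, norm_smul, hN, mul_one, Real.norm_of_nonneg hR]
  constructor <;> intro h <;> linarith

theorem dist_add_smul_self (hR : 0 ≤ R) (hN : ‖N‖ = 1) : dist (x + R • N) x = R := by
  rw [dist_self_add_left, norm_smul, hN, mul_one, Real.norm_of_nonneg hR]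

/-- The radius is the minimum over `y ∈ K` of `‖y - x‖² / (2⟪y - x, N⟫)`, the radius of the ball
tangent at `x` whose boundary passes through `y`. -/
theorem exists_isNearestPoint_of_dist_lt {X K : Set E} (hr : 0 < r) (hN : ‖N‖ = 1)
    (hK : IsCompact K) (hKX : K ⊆ X) (hxK : x ∉ K)
    (hout : ∀ y ∈ X \ K, r ≤ dist (x + r • N) y) (hin : ∃ y ∈ X, dist (x + r • N) y < r)
    (hx : x ∈ X) : ∃ R, 0 < R ∧ R < r ∧ IsNearestPoint X (x + R • N) x ∧
      ∃ y ∈ K, IsNearestPoint X (x + R • N) y := by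
  have hpos : ∀ y ∈ K, 0 < ‖y - x‖ ^ 2 := fun y hy =>
    pow_pos (norm_pos_iff.2 (sub_ne_zero.2 fun h : y = x => hxK (h ▸ hy))) 2
  obtain ⟨y₁, hy₁X, hy₁⟩ := hin
  have hy₁K : y₁ ∈ K := by_contra fun h => (hout y₁ ⟨hy₁X, h⟩).not_gt hy₁
  rw [← not_le, le_dist_add_smul_iff hr.le hN, not_le] at hy₁
  obtain ⟨y₀, hy₀, hmax⟩ := hK.exists_isMaxOn ⟨y₁, hy₁K⟩
    (f := fun y => 2 * inner ℝ (y - x) N / ‖y - x‖ ^ 2)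
    (ContinuousOn.div (by fun_prop) (by fun_prop) fun y hy => (hpos y hy).ne')
  set q := 2 * inner ℝ (y₀ - x) N / ‖y₀ - x‖ ^ 2 with hq
  have hrq : 1 / r < q := by
    refine lt_of_lt_of_le ?_ (hmax hy₁K)
    rw [div_lt_div_iff₀ hr (hpos y₁ hy₁K)]
    linarith
  have hq0 : 0 < q := (one_div_pos.2 hr).trans hrq
  have hR : 0 < q⁻¹ := inv_pos.2 hq0
  have hRr : q⁻¹ < r := by simpa using inv_lt_of_inv_lt₀ hr (one_div r ▸ hrq)
  have hle : ∀ y ∈ X, q⁻¹ ≤ dist (x + q⁻¹ • N) y := fun y hy => by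
    rw [le_dist_add_smul_iff hR.le hN]
    by_cases hyK : y ∈ K
    · rw [inv_mul_le_iff₀ hq0]
      exact (div_le_iff₀ (hpos y hyK)).1 (hmax hyK)
    · have := (le_dist_add_smul_iff hr.le hN).1 (hout y ⟨hy, hyK⟩)
      rcases le_total (2 * inner ℝ (y - x) N) 0 with h | h
      · exact (mul_nonpos_of_nonneg_of_nonpos hR.le h).trans (sq_nonneg _)
      · exact (mul_le_mul_of_nonneg_right hRr.le h).trans this
  have htouch : dist (x + q⁻¹ • N) y₀ = q⁻¹ := by
    rw [dist_add_smul_eq_iff hR.le hN, inv_mul_eq_iff_eq_mul₀ hq0.ne', hq,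
      div_mul_cancel₀ _ (hpos y₀ hy₀).ne']
  exact ⟨q⁻¹, hR, hRr, ⟨hx, fun y hy => (dist_add_smul_self hR.le hN).trans_le (hle y hy)⟩,
    y₀, hy₀, hKX hy₀, fun y hy => htouch.trans_le (hle y hy)⟩

end TangentBall

/-- The curve stays outside both unit discs tangent to it at each of its points, for parameter
distances up to `δ` from the point of tangency. -/
def IsOutsideTangentDiscs (f f' : ℝ → ℂ) (a b δ : ℝ) : Prop :=
  ∀ s ∈ Icc a b, ∀ t ∈ Icc a b, |t - s| ≤ δ → ∀ σ : ℝ, |σ| = 1 →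
    1 ≤ dist (f s + sideNormal f' σ s) (f t)

theorem IsBitangent.lt_abs_sub {f f' : ℝ → ℂ} {a b s t δ : ℝ} {c : ℂ}
    (h : IsBitangent f f' a b s t c) (hf : IsSimpleC1Loop f f' a b)
    (hδ : IsOutsideTangentDiscs f f' a b δ) (hc : dist c (f s) < 1) : δ < |t - s| := by
  by_contra! hle
  have hne : c - f s ≠ 0 := sub_ne_zero.2 fun hc => h.center_notMem (hc ▸ h.nearest_left.mem)
  obtain ⟨σ, hσ, hcs⟩ := exists_eq_mul_sideNormal (hf.ne s) hne
    (hf.re_div_eq_zero_of_isNearestPoint h.left_mem h.nearest_left)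
  rw [sub_eq_iff_eq_add', ← Complex.real_smul] at hcs
  have hN := norm_sideNormal (hf.ne s) hσ
  have hout := hδ s (Ioo_subset_Icc_self h.left_mem) t h.right_mem hle σ hσ
  rw [← one_smul ℝ (sideNormal f' σ s), le_dist_add_smul_iff zero_le_one hN, one_mul] at hout
  have htouch : dist c (f t) = ‖c - f s‖ := by
    rw [← dist_eq_norm]
    exact le_antisymm (h.nearest_right.dist_le _ h.nearest_left.mem)
      (h.nearest_left.dist_le _ h.nearest_right.mem)
  nth_rw 1 [hcs] at htouch
  rw [dist_add_smul_eq_iff (norm_nonneg _) hN] at htouch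
  have hpos : 0 < ‖f t - f s‖ ^ 2 := pow_pos (norm_pos_iff.2 (sub_ne_zero.2 (h.right_ne_left hf))) 2
  rw [dist_eq_norm] at hc
  nlinarith [norm_pos_iff.2 hne]

namespace IsSimpleC1Loop

variable {f f' : ℝ → ℂ} {a b m δ : ℝ}

theorem exists_isBitangent (hf : IsSimpleC1Loop f f' a b) (hδ0 : 0 < δ)
    (hδ : IsOutsideTangentDiscs f f' a b δ)
    (hsmall : ∀ c, indexIntegral f f' a b c ≠ 0 → ∃ y ∈ f '' Icc a b, dist c y < 1)
    (hm : m ∈ Ioo a b) : ∃ n c, IsBitangent f f' a b m n c ∧ dist c (f m) < 1 := by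
  obtain ⟨σ, hσ, k, hk, hside⟩ := hf.exists_isSideValue_ne_zero
  have hN := norm_sideNormal (hf.ne m) hσ
  have hfm : f m ∈ f '' Icc a b := mem_image_of_mem f (Ioo_subset_Icc_self hm)
  have hindex : ∀ R : ℝ, 0 < R →
      IsNearestPoint (f '' Icc a b) (f m + R • sideNormal f' σ m) (f m) →
      indexIntegral f f' a b (f m + R • sideNormal f' σ m) ≠ 0 := fun R hR h => by
    rw [Complex.real_smul] at h ⊢
    rwa [(hf.isSideValue_of_isNearestPoint hσ hR h).unique (hside m hm)]
  set K := f '' {u ∈ Icc a b | δ ≤ |u - m|}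
  have hKc : IsCompact K := (isCompact_Icc.inter_right
    (t := {u | δ ≤ |u - m|}) (isClosed_le continuous_const (by fun_prop))).image hf.continuous
  have hmK : f m ∉ K := by
    rintro ⟨u, ⟨hu, hδu⟩, hum⟩
    rw [hf.eq_of_eq hm hu hum, sub_self, abs_zero] at hδu
    exact hδu.not_gt hδ0
  have hout : ∀ y ∈ f '' Icc a b \ K, 1 ≤ dist (f m + (1 : ℝ) • sideNormal f' σ m) y := by
    rintro _ ⟨⟨u, hu, rfl⟩, huK⟩
    rw [one_smul]
    exact hδ m (Ioo_subset_Icc_self hm) u hu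
      (le_of_not_ge fun hδu => huK ⟨u, ⟨hu, hδu⟩, rfl⟩) σ hσ
  have hin : ∃ y ∈ f '' Icc a b, dist (f m + (1 : ℝ) • sideNormal f' σ m) y < 1 := by
    by_contra! hge
    obtain ⟨y, hy, hy1⟩ := hsmall _ (hindex 1 one_pos
      ⟨hfm, fun y hy => (dist_add_smul_self zero_le_one hN).trans_le (hge y hy)⟩)
    exact (hge y hy).not_gt hy1
  obtain ⟨R, hR, hR1, hleft, _, ⟨n, ⟨hn, hδn⟩, rfl⟩, hright⟩ := exists_isNearestPoint_of_dist_lt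
    one_pos hN hKc (image_mono (sep_subset _ _)) hmK hout hin hfm
  have hdist := dist_add_smul_self (x := f m) hR.le hN
  refine ⟨n, _, ⟨hm, hn, fun hnm => hmK ⟨n, ⟨hn, hδn⟩, hnm ▸ rfl⟩, hleft, hright, fun hc => ?_,
    hindex R hR hleft⟩, hdist.trans_lt hR1⟩
  linarith [hleft.dist_le _ hc, dist_self (f m + R • sideNormal f' σ m)]

theorem exists_indexIntegral_ne_zero_forall_one_le_dist (hf : IsSimpleC1Loop f f' a b)
    (hδ0 : 0 < δ) (hδ : IsOutsideTangentDiscs f f' a b δ) :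
    ∃ c, indexIntegral f f' a b c ≠ 0 ∧ ∀ y ∈ f '' Icc a b, 1 ≤ dist c y := by
  by_contra! hsmall
  have hlt := hf.lt
  have hhalving : ∀ j : ℕ, ∃ s t c, IsBitangent f f' a b s t c ∧ dist c (f s) < 1 ∧
      |t - s| ≤ (b - a) / 2 ^ j := by
    intro j
    induction j with
    | zero =>
      obtain ⟨n, c, h, hc⟩ := hf.exists_isBitangent hδ0 hδ hsmall
        (m := (a + b) / 2) ⟨by linarith, by linarith⟩
      refine ⟨_, n, c, h, hc, ?_⟩
      rw [pow_zero, div_one, abs_le]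
      constructor <;> linarith [h.right_mem.1, h.right_mem.2]
    | succ j ih =>
      obtain ⟨s, t, c, h, -, hle⟩ := ih
      obtain ⟨n, c', h', hc'⟩ := hf.exists_isBitangent hδ0 hδ hsmall (m := (s + t) / 2)
        ⟨by linarith [h.left_mem.1, h.right_mem.1], by linarith [h.left_mem.2, h.right_mem.2]⟩
      obtain ⟨n', h'', hle'⟩ := h.exists_isBitangent_abs_sub_le hf h'
      refine ⟨_, n', c', h'', hc', hle'.trans ?_⟩
      rw [pow_succ, ← div_div]
      linarith
  obtain ⟨j, hj⟩ := pow_unbounded_of_one_lt ((b - a) / δ) (one_lt_two (α := ℝ))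
  obtain ⟨s, t, c, h, hc, hle⟩ := hhalving j
  have hδj : (b - a) / 2 ^ j < δ := by
    rw [div_lt_iff₀ hδ0] at hj
    rw [div_lt_iff₀ (by positivity)]
    linarith
  linarith [h.lt_abs_sub hf hδ hc]

end IsSimpleC1Loop

/-! ### Curves of curvature at most one -/

theorem le_of_hasDerivAt_le {g g' h h' : ℝ → ℝ} {s t : ℝ} (hst : s ≤ t)
    (hg : ∀ u, HasDerivAt g (g' u) u) (hh : ∀ u, HasDerivAt h (h' u) u) (hs : g s ≤ h s)
    (hle : ∀ u ∈ Ico s t, g' u ≤ h' u) : g t ≤ h t :=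
  image_le_of_deriv_right_le_deriv_boundary (fun u _ => (hg u).continuousAt.continuousWithinAt)
    (fun u _ => (hg u).hasDerivWithinAt) hs (fun u _ => (hh u).continuousAt.continuousWithinAt)
    (fun u _ => (hh u).hasDerivWithinAt) hle (right_mem_Icc.2 hst)

/-- The curve `f` has speed `V` and direction `exp (i θ)`, and its direction turns at a rate `K`
not exceeding the speed: its absolute curvature is at most `1` where `V` is positive. -/
structure IsSlowlyTurning (f : ℝ → ℂ) (V θ K : ℝ → ℝ) : Prop where
  deriv u : HasDerivAt f (V u * Complex.exp (θ u * Complex.I)) u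
  angle_deriv u : HasDerivAt θ (K u) u
  speed_cont : Continuous V
  abs_le u : |K u| ≤ V u

namespace IsSlowlyTurning

variable {f : ℝ → ℂ} {V θ K : ℝ → ℝ} {a b s t σ : ℝ}

theorem hasDerivAt_integral_speed (hf : IsSlowlyTurning f V θ K) (s u : ℝ) :
    HasDerivAt (fun u => ∫ v in s..u, V v) (V u) u :=
  (hf.speed_cont.integral_hasStrictDerivAt s u).hasDerivAt

theorem monotone_integral_speed (hf : IsSlowlyTurning f V θ K) (s : ℝ) :
    Monotone fun u => ∫ v in s..u, V v :=
  monotone_of_hasDerivAt_nonneg (hf.hasDerivAt_integral_speed s)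
    fun u => (abs_nonneg _).trans (hf.abs_le u)

theorem abs_angle_sub_le (hf : IsSlowlyTurning f V θ K) (hst : s ≤ t) :
    |θ t - θ s| ≤ ∫ u in s..t, V u :=
  image_norm_le_of_norm_deriv_right_le_deriv_boundary (f := fun u => θ u - θ s)
    (fun u _ => ((hf.angle_deriv u).sub_const _).continuousAt.continuousWithinAt)
    (fun u _ => ((hf.angle_deriv u).sub_const _).hasDerivWithinAt) (by simp)
    (hf.hasDerivAt_integral_speed s) (fun u _ => hf.abs_le u) (right_mem_Icc.2 hst)

theorem hasDerivAt_sub_mul_exp_neg (hf : IsSlowlyTurning f V θ K) (s u : ℝ) :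
    HasDerivAt (fun u => (f u - f s) * Complex.exp (-(θ s * Complex.I)))
      (V u * Complex.exp ((θ u - θ s : ℝ) * Complex.I)) u := by
  refine (((hf.deriv u).sub_const _).mul_const _).congr_deriv ?_
  rw [mul_assoc, ← Complex.exp_add, Complex.ofReal_sub]
  ring_nf

theorem sin_le_re_sub_mul_exp_neg (hf : IsSlowlyTurning f V θ K) (hst : s ≤ t)
    (hlen : ∫ u in s..t, V u ≤ Real.pi) :
    Real.sin (∫ u in s..t, V u) ≤ ((f t - f s) * Complex.exp (-(θ s * Complex.I))).re := by
  refine le_of_hasDerivAt_le hst (fun u => (hf.hasDerivAt_integral_speed s u).sin)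
    (fun u => Complex.reCLM.hasFDerivAt.comp_hasDerivAt u (hf.hasDerivAt_sub_mul_exp_neg s u))
    (by simp) fun u hu => ?_
  rw [Complex.reCLM_apply, Complex.re_ofReal_mul, Complex.exp_ofReal_mul_I_re, mul_comm,
    ← Real.cos_abs (θ u - θ s)]
  exact mul_le_mul_of_nonneg_left (Real.cos_le_cos_of_nonneg_of_le_pi (abs_nonneg _)
    ((hf.monotone_integral_speed s hu.2.le).trans hlen) (hf.abs_angle_sub_le hu.1))
    ((abs_nonneg _).trans (hf.abs_le u))

theorem mul_im_sub_mul_exp_neg_le (hf : IsSlowlyTurning f V θ K) (hst : s ≤ t) (hσ : |σ| = 1)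
    (hlen : ∫ u in s..t, V u ≤ Real.pi / 2) :
    σ * ((f t - f s) * Complex.exp (-(θ s * Complex.I))).im ≤
      1 - Real.cos (∫ u in s..t, V u) := by
  refine le_of_hasDerivAt_le hst (fun u => (Complex.imCLM.hasFDerivAt.comp_hasDerivAt u
    (hf.hasDerivAt_sub_mul_exp_neg s u)).const_mul σ)
    (fun u => (hf.hasDerivAt_integral_speed s u).cos.const_sub 1) (by simp) fun u hu => ?_
  have hturn := hf.abs_angle_sub_le hu.1
  have hlen' := (hf.monotone_integral_speed s hu.2.le).trans hlen
  have hsin : σ * Real.sin (θ u - θ s) ≤ Real.sin (∫ v in s..u, V v) := calc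
    σ * Real.sin (θ u - θ s) ≤ |σ * Real.sin (θ u - θ s)| := le_abs_self _
    _ = Real.sin |θ u - θ s| := by
      rw [abs_mul, hσ, one_mul, Real.abs_sin_eq_sin_abs_of_abs_le_pi
        (by linarith [Real.pi_pos])]
    _ ≤ Real.sin (∫ v in s..u, V v) := Real.sin_le_sin_of_le_of_le_pi_div_two
      (by linarith [Real.pi_pos, abs_nonneg (θ u - θ s)]) hlen' hturn
  rw [Complex.imCLM_apply, Complex.im_ofReal_mul, Complex.exp_ofReal_mul_I_im]
  linarith [mul_le_mul_of_nonneg_left hsin ((abs_nonneg _).trans (hf.abs_le u))]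

/-- Among all curves with the same start and of curvature at most `1`, the unit circle turns
fastest: it minimises the coordinate along the initial tangent and maximises the other one. -/
theorem one_le_dist_of_le (hf : IsSlowlyTurning f V θ K) (hst : s ≤ t) (hσ : |σ| = 1)
    (hlen : ∫ u in s..t, V u ≤ Real.pi / 2) :
    1 ≤ dist (f s + σ * Complex.I * Complex.exp (θ s * Complex.I)) (f t) := by
  set L := ∫ u in s..t, V u
  set w := (f t - f s) * Complex.exp (-(θ s * Complex.I))
  have hL : 0 ≤ L := (abs_nonneg _).trans (hf.abs_angle_sub_le hst)
  have hre : Real.sin L ≤ w.re :=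
    hf.sin_le_re_sub_mul_exp_neg hst (hlen.trans (half_le_self Real.pi_pos.le))
  have him : σ * w.im ≤ 1 - Real.cos L := hf.mul_im_sub_mul_exp_neg_le hst hσ hlen
  have hsin : 0 ≤ Real.sin L :=
    Real.sin_nonneg_of_nonneg_of_le_pi hL (by linarith [Real.pi_pos])
  have hcos : 0 ≤ Real.cos L := Real.cos_nonneg_of_mem_Icc ⟨by linarith [Real.pi_pos], hlen⟩
  have hσ2 : σ ^ 2 = 1 := by rw [← sq_abs, hσ, one_pow]
  have hdist : dist (f s + σ * Complex.I * Complex.exp (θ s * Complex.I)) (f t) =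
      ‖w - σ * Complex.I‖ := by
    have hexp : Complex.exp (-(θ s * Complex.I)) * Complex.exp (θ s * Complex.I) = 1 := by
      rw [← Complex.exp_add, neg_add_cancel, Complex.exp_zero]
    rw [dist_comm, dist_eq_norm, ← mul_one ‖w - _‖, ← Complex.norm_exp_ofReal_mul_I (θ s),
      ← norm_mul]
    congr 1
    linear_combination (f s - f t) * hexp
  have hnorm : ‖w - σ * Complex.I‖ ^ 2 = w.re ^ 2 + (1 - σ * w.im) ^ 2 := by
    rw [← Complex.normSq_eq_norm_sq, Complex.normSq_apply]
    simp only [Complex.sub_re, Complex.sub_im, Complex.re_ofReal_mul, Complex.im_ofReal_mul,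
      Complex.I_re, Complex.I_im]
    linear_combination (1 - w.im ^ 2) * hσ2
  rw [hdist, ← one_le_sq_iff₀ (norm_nonneg _), hnorm]
  calc 1 = Real.sin L ^ 2 + Real.cos L ^ 2 := (Real.sin_sq_add_cos_sq L).symm
    _ ≤ w.re ^ 2 + (1 - σ * w.im) ^ 2 := by gcongr; linarith

theorem comp_neg (hf : IsSlowlyTurning f V θ K) :
    IsSlowlyTurning (fun u => f (-u)) (fun u => V (-u)) (fun u => θ (-u) + Real.pi)
      fun u => -K (-u) where
  deriv u := by
    refine ((hf.deriv (-u)).scomp u (hasDerivAt_neg u)).congr_deriv ?_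
    rw [neg_one_smul, Complex.ofReal_add, add_mul, Complex.exp_add, Complex.exp_pi_mul_I]
    ring
  angle_deriv u := by
    simpa using ((hf.angle_deriv (-u)).comp u (hasDerivAt_neg u)).add_const Real.pi
  speed_cont := hf.speed_cont.comp continuous_neg
  abs_le u := (abs_neg _).trans_le (hf.abs_le (-u))

theorem one_le_dist (hf : IsSlowlyTurning f V θ K) (hσ : |σ| = 1)
    (hlen : |∫ u in s..t, V u| ≤ Real.pi / 2) :
    1 ≤ dist (f s + σ * Complex.I * Complex.exp (θ s * Complex.I)) (f t) := by
  rcases le_total s t with hst | hts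
  · exact hf.one_le_dist_of_le hst hσ ((le_abs_self _).trans hlen)
  · have hback := hf.comp_neg.one_le_dist_of_le (σ := -σ) (neg_le_neg hts) (by rwa [abs_neg]) ?_
    · rw [Complex.ofReal_add, add_mul, Complex.exp_add, Complex.exp_pi_mul_I] at hback
      simpa only [neg_neg, Complex.ofReal_neg, neg_mul, mul_neg, mul_one] using hback
    · rw [intervalIntegral.integral_comp_neg, neg_neg, neg_neg]
      rw [intervalIntegral.integral_symm, abs_neg] at hlen
      exact (le_abs_self _).trans hlen

theorem exists_isOutsideTangentDiscs (hf : IsSlowlyTurning f V θ K) (hV : ∀ u, 0 < V u)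
    (a b : ℝ) : ∃ δ > 0,
      IsOutsideTangentDiscs f (fun u => V u * Complex.exp (θ u * Complex.I)) a b δ := by
  obtain ⟨M, hM⟩ := (isCompact_Icc (a := a) (b := b)).exists_bound_of_continuousOn
    hf.speed_cont.continuousOn
  refine ⟨Real.pi / 2 / (|M| + 1), by positivity, fun s hs t ht hst σ hσ => ?_⟩
  have hnormal : sideNormal (fun u => V u * Complex.exp (θ u * Complex.I)) σ s =
      σ * Complex.I * Complex.exp (θ s * Complex.I) := by
    have : (V s : ℂ) ≠ 0 := by exact_mod_cast (hV s).ne'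
    rw [sideNormal, norm_mul, Complex.norm_exp_ofReal_mul_I, mul_one, Complex.norm_real,
      Real.norm_of_nonneg (hV s).le]
    field_simp
  rw [hnormal]
  refine hf.one_le_dist hσ ?_
  calc |∫ u in s..t, V u| ≤ (|M| + 1) * |t - s| :=
        intervalIntegral.norm_integral_le_of_norm_le_const fun u hu =>
          (hM u (uIcc_subset_Icc hs ht (uIoc_subset_uIcc hu))).trans
            ((le_abs_self M).trans (lt_add_one _).le)
    _ ≤ (|M| + 1) * (Real.pi / 2 / (|M| + 1)) := by gcongr
    _ = Real.pi / 2 := by field_simp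

theorem isSimpleC1Loop (hf : IsSlowlyTurning f V θ K) (hV : ∀ u, 0 < V u) (hab : a < b)
    (hclosed : f a = f b) (hinj : InjOn f (Ico a b)) :
    IsSimpleC1Loop f (fun u => V u * Complex.exp (θ u * Complex.I)) a b where
  deriv := hf.deriv
  cont := by
    have hθ : Continuous θ := continuous_iff_continuousAt.2 fun u =>
      (hf.angle_deriv u).continuousAt
    have hV := hf.speed_cont
    fun_prop
  lt := hab
  ne u := mul_ne_zero (by exact_mod_cast (hV u).ne') (Complex.exp_ne_zero _)
  closed := hclosed
  inj := hinj

end IsSlowlyTurning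

theorem exists_continuous_eqOn_Icc {α : Type*} [TopologicalSpace α] {h : ℝ → α} {a b : ℝ}
    (hab : a ≤ b) (hh : ContinuousOn h (Icc a b)) :
    ∃ H : ℝ → α, Continuous H ∧ EqOn H h (Icc a b) ∧ ∀ u, H u ∈ h '' Icc a b := by
  refine ⟨IccExtend hab ((Icc a b).domRestrict h), hh.domRestrict.Icc_extend',
    fun u hu => IccExtend_of_mem hab _ hu, fun u => ?_⟩
  exact mem_image_of_mem h (projIcc a b hab u).2

theorem eqOn_Icc_of_hasDerivWithinAt {E : Type*} [NormedAddCommGroup E] [NormedSpace ℝ E]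
    {g h h' : ℝ → E} {a b : ℝ} (hg : ∀ u ∈ Icc a b, HasDerivWithinAt g (h' u) (Icc a b) u)
    (hh : ∀ u ∈ Icc a b, HasDerivWithinAt h (h' u) (Icc a b) u) (ha : g a = h a) :
    EqOn g h (Icc a b) :=
  have hright {k : ℝ → E} (hk : ∀ u ∈ Icc a b, HasDerivWithinAt k (h' u) (Icc a b) u) :
      ∀ u ∈ Ico a b, HasDerivWithinAt k (h' u) (Ici u) u := fun u hu =>
    (hk u (Ico_subset_Icc_self hu)).mono_of_mem_nhdsWithin
      (mem_of_superset (Icc_mem_nhdsGE hu.2) (Icc_subset_Icc_left hu.1))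
  eq_of_has_deriv_right_eq (hright hg) (hright hh)
    (fun u hu => (hg u hu).continuousWithinAt) (fun u hu => (hh u hu).continuousWithinAt) ha

theorem hasDerivWithinAt_eq_im_mul_I_mul {T : ℝ → ℂ} {T' : ℂ} {S : Set ℝ} {u : ℝ}
    (hS : UniqueDiffWithinAt ℝ S u) (hu : u ∈ S) (hT : HasDerivWithinAt T T' S u)
    (hT1 : ∀ w ∈ S, ‖T w‖ = 1) :
    T' = (starRingEnd ℂ (T u) * T').im * Complex.I * T u := by
  have hconst : HasDerivWithinAt (fun w => ‖T w‖ ^ 2) 0 S u :=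
    (hasDerivWithinAt_const u S (1 : ℝ)).congr (fun w hw => by rw [hT1 w hw, one_pow])
      (by rw [hT1 u hu, one_pow])
  have hre : (starRingEnd ℂ (T u) * T').re = 0 := by
    have h := hS.eq_deriv S hT.norm_sq hconst
    rw [Complex.inner, mul_comm T'] at h
    linarith
  have hunit : starRingEnd ℂ (T u) * T u = 1 := by
    rw [mul_comm, Complex.mul_conj, Complex.normSq_eq_norm_sq, hT1 u hu, one_pow,
      Complex.ofReal_one]
  have him : starRingEnd ℂ (T u) * T' = (starRingEnd ℂ (T u) * T').im * Complex.I := by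
    conv_lhs => rw [← Complex.re_add_im (starRingEnd ℂ (T u) * T'), hre, Complex.ofReal_zero,
      zero_add]
  rw [← him]
  linear_combination -T' * hunit

theorem exists_angle {T : ℝ → ℂ} {K : ℝ → ℝ} {a b : ℝ} (hK : Continuous K) (hTa : ‖T a‖ = 1)
    (hT : ∀ u ∈ Icc a b, HasDerivWithinAt T (K u * Complex.I * T u) (Icc a b) u) :
    ∃ θ : ℝ → ℝ, (∀ u, HasDerivAt θ (K u) u) ∧
      ∀ u ∈ Icc a b, T u = Complex.exp (θ u * Complex.I) := by
  set θ : ℝ → ℝ := fun u => (T a).arg + ∫ w in a..u, K w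
  have hθ (u : ℝ) : HasDerivAt θ (K u) u :=
    ((hK.integral_hasStrictDerivAt a u).hasDerivAt).const_add _
  have hθa : T a = Complex.exp (θ a * Complex.I) := by
    simpa [θ, hTa] using (Complex.norm_mul_exp_arg_mul_I (T a)).symm
  have hquot : EqOn (fun u => T u * Complex.exp (-(θ u * Complex.I))) (fun _ => 1) (Icc a b) := by
    refine eqOn_Icc_of_hasDerivWithinAt (h' := fun _ => 0) (fun u hu => ?_)
      (fun u _ => hasDerivWithinAt_const u _ 1) ?_
    · have hexp := ((hθ u).ofReal_comp.mul_const Complex.I).fun_neg.cexp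
      refine ((hT u hu).mul hexp.hasDerivWithinAt).congr_deriv ?_
      ring
    · rw [hθa, ← Complex.exp_add, add_neg_cancel, Complex.exp_zero]
  refine ⟨θ, hθ, fun u hu => ?_⟩
  have h : T u * Complex.exp (-(θ u * Complex.I)) = 1 := hquot hu
  rwa [Complex.exp_neg, mul_inv_eq_one₀ (Complex.exp_ne_zero _)] at h

theorem exists_isSlowlyTurning_eqOn {g T T' : ℝ → ℂ} {v : ℝ → ℝ} {a b : ℝ} (hab : a < b)
    (hg : ∀ u ∈ Icc a b, HasDerivWithinAt g (v u * T u) (Icc a b) u)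
    (hT : ∀ u ∈ Icc a b, HasDerivWithinAt T (T' u) (Icc a b) u)
    (hvc : ContinuousOn v (Icc a b)) (hT'c : ContinuousOn T' (Icc a b))
    (hv : ∀ u ∈ Icc a b, 0 < v u) (hT1 : ∀ u ∈ Icc a b, ‖T u‖ = 1)
    (hT'v : ∀ u ∈ Icc a b, ‖T' u‖ ≤ v u) :
    ∃ (f : ℝ → ℂ) (V θ K : ℝ → ℝ), IsSlowlyTurning f V θ K ∧ (∀ u, 0 < V u) ∧
      EqOn f g (Icc a b) := by
  set k : ℝ → ℝ := fun u => (starRingEnd ℂ (T u) * T' u).im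
  have hkc : ContinuousOn k (Icc a b) := Complex.continuous_im.comp_continuousOn
    ((Complex.continuous_conj.comp_continuousOn fun u hu => (hT u hu).continuousWithinAt).mul hT'c)
  have hkv : ∀ u ∈ Icc a b, |k u| ≤ v u := fun u hu => calc
    |k u| ≤ ‖starRingEnd ℂ (T u) * T' u‖ := Complex.abs_im_le_norm _
    _ = ‖T' u‖ := by rw [norm_mul, RCLike.norm_conj, hT1 u hu, one_mul]
    _ ≤ v u := hT'v u hu
  obtain ⟨P, hPc, hP, hPmem⟩ := exists_continuous_eqOn_Icc hab.le (hvc.prodMk hkc)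
  have hbound (u : ℝ) : 0 < (P u).1 ∧ |(P u).2| ≤ (P u).1 := by
    obtain ⟨w, hw, hwu⟩ := hPmem u
    rw [← hwu]
    exact ⟨hv w hw, hkv w hw⟩
  obtain ⟨θ, hθ, hTθ⟩ := exists_angle (T := T) (b := b) (K := fun u => (P u).2) (by fun_prop)
    (hT1 a (left_mem_Icc.2 hab.le)) fun u hu => (hT u hu).congr_deriv <| by
      rw [hP hu]
      exact hasDerivWithinAt_eq_im_mul_I_mul (uniqueDiffOn_Icc hab u hu) hu (hT u hu) hT1
  have hθc : Continuous θ := continuous_iff_continuousAt.2 fun u => (hθ u).continuousAt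
  have hf'c : Continuous fun u => ((P u).1 : ℂ) * Complex.exp (θ u * Complex.I) := by fun_prop
  have hf (u : ℝ) := ((hf'c.integral_hasStrictDerivAt a u).hasDerivAt).const_add (g a)
  refine ⟨_, fun u => (P u).1, θ, fun u => (P u).2, ⟨hf, hθ, by fun_prop, fun u => (hbound u).2⟩,
    fun u => (hbound u).1, eqOn_Icc_of_hasDerivWithinAt
      (fun u _ => (hf u).hasDerivWithinAt) (fun u hu => ?_) (by simp)⟩
  simpa only [hP hu, ← hTθ u hu] using hg u hu

namespace IsSimpleC1Loop

variable {f f' : ℝ → ℂ} {a b r : ℝ} {c z : ℂ}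

theorem isBounded_connectedComponentIn (hf : IsSimpleC1Loop f f' a b)
    (hz : indexIntegral f f' a b z ≠ 0) :
    Bornology.IsBounded (connectedComponentIn (f '' Icc a b)ᶜ z) := by
  by_cases hzΓ : z ∈ (f '' Icc a b)ᶜ
  swap
  · rw [connectedComponentIn_eq_empty hzΓ]
    exact Bornology.isBounded_empty
  obtain ⟨R, hR⟩ := isBounded_iff_forall_norm_le.1 (hf.isCompact_image a b).isBounded
  refine isBounded_iff_forall_norm_le.2 ⟨max R 0, fun w hw => ?_⟩
  by_contra! hlt
  have hw0 : w ≠ 0 := norm_pos_iff.1 ((le_max_right _ _).trans_lt hlt)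
  refine hz ?_
  rw [hf.indexIntegral_eq_of_isPreconnected isPreconnected_connectedComponentIn
    (connectedComponentIn_subset _ _) (mem_connectedComponentIn hzΓ) hw]
  refine hf.indexIntegral_eq_zero_of_ray hf.lt.le hf.closed hw0 fun r hr hmem => ?_
  have hnorm : ‖w + r * w‖ = (1 + r) * ‖w‖ := by
    rw [← one_add_mul, norm_mul, ← Complex.ofReal_one, ← Complex.ofReal_add, Complex.norm_real,
      Real.norm_of_nonneg (by positivity)]
  nlinarith [hR _ hmem, le_max_left R 0, norm_nonneg w]

theorem isBounded_connectedComponentIn_of_mem_closedBall (hf : IsSimpleC1Loop f f' a b)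
    (hc : indexIntegral f f' a b c ≠ 0) (hr : ∀ y ∈ f '' Icc a b, r ≤ dist c y)
    (hz : z ∈ Metric.closedBall c r) (hzΓ : z ∉ f '' Icc a b) :
    Bornology.IsBounded (connectedComponentIn (f '' Icc a b)ᶜ z) := by
  refine hf.isBounded_connectedComponentIn fun hz0 => hc ?_
  rw [← hz0]
  refine hf.indexIntegral_eq_of_isPreconnected (convex_segment c z).isPreconnected
    (fun w hw hwΓ => hzΓ ?_) (left_mem_segment ℝ c z) (right_mem_segment ℝ c z)
  have hwz : w = z := dist_le_zero.1 (by
    linarith [dist_add_dist_of_mem_segment hw, hr w hwΓ, Metric.mem_closedBall'.1 hz])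
  exact hwz ▸ hwΓ

end IsSimpleC1Loop

/-! ### The Euclidean plane -/

/-- The identification of the Euclidean plane with the complex plane. -/
noncomputable def planeToComplex : Plane ≃ₗᵢ[ℝ] ℂ := Complex.orthonormalBasisOneI.repr.symm

theorem exists_isSlowlyTurning_of_absCurvature_le_one {γ : ℝ → Plane} {a b : ℝ} (hab : a < b)
    (hγ : ContDiffOn ℝ 2 γ (Icc a b)) (hreg : ∀ t ∈ Icc a b, derivWithin γ (Icc a b) t ≠ 0)
    (hκ : ∀ t ∈ Icc a b, absCurvature γ (Icc a b) t ≤ 1) :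
    ∃ (f : ℝ → ℂ) (V θ K : ℝ → ℝ), IsSlowlyTurning f V θ K ∧ (∀ u, 0 < V u) ∧
      EqOn f (planeToComplex ∘ γ) (Icc a b) := by
  have hU := uniqueDiffOn_Icc hab
  have hpos : ∀ u ∈ Icc a b, 0 < ‖derivWithin γ (Icc a b) u‖ := fun u hu =>
    norm_pos_iff.2 (hreg u hu)
  have hγ' : ContDiffOn ℝ 1 (derivWithin γ (Icc a b)) (Icc a b) :=
    hγ.derivWithin hU one_add_one_eq_two.le
  have hspeed : ContDiffOn ℝ 1 (fun u => ‖derivWithin γ (Icc a b) u‖) (Icc a b) :=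
    hγ'.norm ℝ hreg
  have hT : ContDiffOn ℝ 1 (unitTangent γ (Icc a b)) (Icc a b) :=
    (hspeed.inv fun u hu => (hpos u hu).ne').smul hγ'
  have hcomp {h : ℝ → Plane} {n : WithTop ℕ∞} (hh : ContDiffOn ℝ n h (Icc a b)) (hn : n ≠ 0) :
      ∀ u ∈ Icc a b, HasDerivWithinAt (planeToComplex ∘ h)
        (planeToComplex (derivWithin h (Icc a b) u)) (Icc a b) u := fun u hu =>
    planeToComplex.toContinuousLinearEquiv.hasFDerivAt.comp_hasDerivWithinAt u
      (hh.differentiableOn hn u hu).hasDerivWithinAt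
  refine exists_isSlowlyTurning_eqOn hab (fun u hu => (hcomp hγ two_ne_zero u hu).congr_deriv ?_)
    (hcomp hT one_ne_zero) hspeed.continuousOn (planeToComplex.continuous.comp_continuousOn
      (hT.continuousOn_derivWithin hU le_rfl)) hpos (fun u hu => ?_) fun u hu => ?_
  · rw [Function.comp_apply, ← Complex.real_smul, ← map_smul, unitTangent,
      smul_inv_smul₀ (hpos u hu).ne']
  · rw [Function.comp_apply, LinearIsometryEquiv.norm_map, unitTangent, norm_smul, norm_inv,
      norm_norm, inv_mul_cancel₀ (hpos u hu).ne']
  · rw [LinearIsometryEquiv.norm_map]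
    exact (div_le_one (hpos u hu)).1 (hκ u hu)

theorem surrounds_of_image_planeToComplex {Γ : Set Plane} {c : ℂ} {r : ℝ}
    (h : ∀ z ∈ Metric.closedBall c r, z ∉ planeToComplex '' Γ →
      Bornology.IsBounded (connectedComponentIn (planeToComplex '' Γ)ᶜ z)) :
    Surrounds Γ (Metric.closedBall (planeToComplex.symm c) r) := by
  intro x hx
  by_cases hxΓ : x ∈ Γ
  · exact Or.inl hxΓ
  refine Or.inr ⟨hxΓ, ?_⟩
  have hbounded := h (planeToComplex x)
    (by rwa [Metric.mem_closedBall, ← planeToComplex.dist_map,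
      LinearIsometryEquiv.apply_symm_apply] at hx)
    (planeToComplex.injective.mem_set_image.not.2 hxΓ)
  have himage := planeToComplex.toHomeomorph.image_connectedComponentIn
    (s := Γᶜ) hxΓ
  rw [image_compl_eq planeToComplex.toHomeomorph.bijective] at himage
  obtain ⟨R, hR⟩ := isBounded_iff_forall_norm_le.1 hbounded
  refine isBounded_iff_forall_norm_le.2 ⟨R, fun y hy => ?_⟩
  rw [← planeToComplex.norm_map]
  exact hR _ (himage.subset (mem_image_of_mem _ hy))

theorem mainTheorem1_general (γ : ℝ → Plane) (a b : ℝ) (hab : a < b)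
    (hγ : ContDiffOn ℝ 2 γ (Icc a b)) (hreg : ∀ t ∈ Icc a b, derivWithin γ (Icc a b) t ≠ 0)
    (hclosed : γ a = γ b) (hsimple : InjOn γ (Ico a b))
    (hκ : ∀ t ∈ Icc a b, absCurvature γ (Icc a b) t ≤ 1) :
    ∃ c : Plane, Surrounds (γ '' Icc a b) (Metric.closedBall c 1) := by
  obtain ⟨f, V, θ, K, hturn, hV, hfγ⟩ :=
    exists_isSlowlyTurning_of_absCurvature_le_one hab hγ hreg hκ
  obtain ⟨δ, hδ0, hδ⟩ := hturn.exists_isOutsideTangentDiscs hV a b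
  have hf := hturn.isSimpleC1Loop hV hab
    (by rw [hfγ (left_mem_Icc.2 hab.le), hfγ (right_mem_Icc.2 hab.le), Function.comp_apply,
      hclosed, Function.comp_apply])
    ((planeToComplex.injective.comp_injOn hsimple).congr (hfγ.symm.mono Ico_subset_Icc_self))
  obtain ⟨c, hc, hdist⟩ := hf.exists_indexIntegral_ne_zero_forall_one_le_dist hδ0 hδ
  have himage : f '' Icc a b = planeToComplex '' (γ '' Icc a b) := by
    rw [hfγ.image_eq, image_comp]
  refine ⟨planeToComplex.symm c, surrounds_of_image_planeToComplex ?_⟩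
  rw [← himage]
  exact fun z => hf.isBounded_connectedComponentIn_of_mem_closedBall hc hdist

theorem mainTheorem1 (γ : ℝ → Plane) (a b : ℝ) (hγ : IsSimpleSmoothRegularLoop γ a b)
    (hκ : ∀ t ∈ Set.Icc a b, absCurvature γ (Set.Icc a b) t ≤ 1) :
    ∃ c : Plane, Surrounds (γ '' Set.Icc a b) (Metric.closedBall c 1) :=
  mainTheorem1_general γ a b hγ.lt (contDiffOn_infty.1 hγ.smooth 2) hγ.regular hγ.closed
    hγ.simple hκ
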